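/- **Setting.** For each $n\ge 1$ let $\mathbf X=\mathbf X_n\in\mathbb R^{n\times p(n)}$ be a random design matrix, $\boldsymbol\beta=\boldsymbol\beta_n\in\mathbb R^{p(n)}$ a signal, $\boldsymbol\epsilon=\boldsymbol\epsilon_n\in\mathbb R^{n}$ a noise vector, all on one probability space, and let $\mathbf y=\mathbf X\boldsymbol\beta+\boldsymbol\epsilon$. Assume: 1. $\mathbf X_n$ is right-rotationally invariant: $\mathbf X_n\mathbf O\stackrel{d}{=}\mathbf X_n$ for every orthogonal $p(n)\times p(n)$ matrix $\mathbf O$. 2. There is a constant $C$ such that, almost surely, $\limsup_{n\to\infty}\|\mathbf X_n\|_{\mathrm{op}}<C$ (i.e. the largest singular values of $\mathbf X_n$ are asymptotically bounded). 3. $p(n)/n\to\gamma\in(0,\infty)$. 4. $\boldsymbol\beta_n$ is fixed, or random and independent of $\mathbf X_n$, with $\|\boldsymbol\beta_n\|/\sqrt n=r$ (almost surely) for all $n$; $\boldsymbol\epsilon_n$ is independent of $(\mathbf X_n,\boldsymbol\beta_n)$. 5. For each $n$ the entries $\epsilon_{n,1},\dots,\epsilon_{n,n}$ are independent (not necessarily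 identically distributed), with $\mathbb E[\epsilon_{n,i}]=0$, $\mathbb E[\epsilon_{n,i}^2]=\sigma^2$, and $\sup_{n,i}\mathbb E|\epsilon_{n,i}|^{4+\eta}<\infty$ for some $\eta>0$. For $\lambda>0$ let $\mathbf S_\lambda=\mathbf X(\mathbf X^\top\mathbf X+\lambda\mathbf I)^{-1}\mathbf X^\top$. Let $v_{\mathbf D}$ be the companion Stieltjes transform of $\mathbf X$, i.e. the Stieltjes transform of the empirical distribution of the eigenvalues $e_1,\dots,e_n\ge 0$ of $\mathbf X\mathbf X^\top$ (equivalently, of the diagonal entries of $\mathbf D\mathbf D^\top$, where $\mathbf X=\mathbf Q^\top\mathbf D\mathbf O$ is a singular value decomposition): $$v_{\mathbf D}(z)=\frac1n\sum_{i=1}^n\frac1{e_i-z}.$$ **Lemma.** For every $\lambda>0$, $$\frac1n\,\mathbf y^\top(\mathbf I-\mathbf S_\lambda)^2\mathbf y-\left[r^2\,\frac{\lambda^2}{\gamma}\bigl(v_{\mathbf D}(-\lambda)-\lambda v_{\mathbf D}'(-\lambda)\bigr)+\sigma^2\lambda^2 v_{\mathbf D}'(-\lambda)\right]\longrightarrow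 0\quad\text{almost surely as } n\to\infty .$$ -/

import Mathlib

open MeasureTheory ProbabilityTheory Filter Topology
open scoped Matrix ENNReal NNReal

/-- Matrices carry the product (entrywise) sigma-algebra. -/
instance Matrix.instMeasurableSpaceEntrywise {m n : Type*} :
    MeasurableSpace (Matrix m n ℝ) :=
  inferInstanceAs (MeasurableSpace (m → n → ℝ))

/-- A random design `X` is right-rotationally invariant if `X O` has the same law as `X`
for every orthogonal `p × p` matrix `O`. -/
def IsRightRotationallyInvariant {Ω : Type*} [MeasurableSpace Ω] (μ : Measure Ω) {n p : ℕ}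
    (X : Ω → Matrix (Fin n) (Fin p) ℝ) : Prop :=
  ∀ O ∈ Matrix.orthogonalGroup (Fin p) ℝ, IdentDistrib (fun ω => X ω * O) X μ μ

/-- The largest singular value of `X`: the operator norm of `X` as a linear map between
Euclidean spaces. -/
noncomputable def maxSingularValue {n p : ℕ} (X : Matrix (Fin n) (Fin p) ℝ) : ℝ :=
  ‖(Matrix.toEuclideanLin X).toContinuousLinearMap‖

/-- The empirical distribution `(1/n) ∑ᵢ δ_{x i}` of the entries of `x`. -/
noncomputable def empiricalDistribution {n : ℕ} (x : Fin n → ℝ) : Measure ℝ :=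
  (n : ℝ≥0∞)⁻¹ • ∑ i, Measure.dirac (x i)

/-- The companion Stieltjes transform `v_D(z)` of a design `X` with singular value decomposition
`X = Qᵀ D O`. The `n` diagonal entries of `D Dᵀ` are the eigenvalues of `X Xᵀ` with multiplicity,
and `v_D(z) = ∫ (x - z)⁻¹ dν(x)` where `ν` is their empirical distribution. -/
noncomputable def companionStieltjes {n p : ℕ} (X : Matrix (Fin n) (Fin p) ℝ) (z : ℝ) : ℝ :=
  resolventTransform
    (empiricalDistribution (Matrix.isHermitian_mul_conjTranspose_self X).eigenvalues) z

/-- The ridge smoother matrix `S_λ = X (Xᵀ X + λ I)⁻¹ Xᵀ`. -/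
noncomputable def ridgeSmoother {n p : ℕ} (X : Matrix (Fin n) (Fin p) ℝ) (lam : ℝ) :
    Matrix (Fin n) (Fin n) ℝ :=
  X * (Xᵀ * X + lam • (1 : Matrix (Fin p) (Fin p) ℝ))⁻¹ * Xᵀ

/-- The normalized training error `(1/n) yᵀ (I - S_λ)² y` of ridge regression. -/
noncomputable def trainingError {n p : ℕ} (X : Matrix (Fin n) (Fin p) ℝ) (y : Fin n → ℝ)
    (lam : ℝ) : ℝ :=
  (1 / (n : ℝ)) * (y ⬝ᵥ ((1 - ridgeSmoother X lam) ^ 2 *ᵥ y))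

/-! Write `R = (X Xᵀ + λ I)⁻¹`. The push-through identity gives `I - S_λ = λ R`, so the training
error is `λ² / n` times the sum of a signal form `βᵀ Xᵀ R² X β`, a cross term `2 (R² X β) · ε` and a
noise form `εᵀ R² ε`. The cross term is negligible, and the two forms concentrate around multiples
of `tr (Xᵀ R² X) = tr R - λ tr R²` and of `tr R²`. Since `v_D(-λ)` and `v_D'(-λ)` are the normalized
traces of `R` and `R²`, this is the claimed limit, up to replacing `n / p` by `1 / γ`.

Almost sure convergence comes from moments of an order `q > 2`: fluctuations with `q`-th moment `O(n
^ (q / 2))` have summable moments after division by `n` (`ae_tendsto_div_of_moment_le`), whatever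
the dependence between different `n`. The moment bound is `integral_abs_centredForm_le`: the
independent variables are added one at a time, each increment is centred given the past, and a
second order Taylor inequality for `|·| ^ q` makes the scales of the increments add up
(`integral_abs_add_rpow_le`). For the noise it is applied conditionally on design and signal; the
resolvent bounds depend on `λ` alone, so it is uniform in the design.

The signal has no independent coordinates. By rotational invariance, however, the law of its
deviation depends on the signal only through its norm, so a fixed signal may be replaced by a random
sign vector of the same norm, independent of the design, and the same moment inequality applies
(`lintegral_signalDeviation_le`). -/

/-! ### A second order moment inequality for sums of orthogonal increments -/

/-- The constant in the second order expansion of `|s + z| ^ q`. -/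
noncomputable def taylorConst (q : ℝ) : ℝ := (q + 1) ^ q + q ^ 2

lemma one_le_taylorConst {q : ℝ} (hq : 2 < q) : 1 ≤ taylorConst q := by
  have : 0 ≤ (q + 1) ^ q := by positivity
  unfold taylorConst
  nlinarith

/-- Near zero, `1 + t ≤ exp t` reduces the claim to the quadratic bound for the exponential. Away
from zero, `1 < q |t|`, so `|t| ^ q` dominates the left side and `q² t²` absorbs a negative linear
term. -/
lemma abs_one_add_rpow_le {q : ℝ} (hq : 2 < q) (t : ℝ) :
    |1 + t| ^ q ≤ 1 + q * t + taylorConst q * (t ^ 2 + |t| ^ q) := by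
  have hq0 : 0 < q := by linarith
  have h1 : 0 ≤ (q + 1) ^ q := by positivity
  have h2 : 0 ≤ |t| ^ q := by positivity
  unfold taylorConst
  by_cases ht : |q * t| ≤ 1
  · have h3 := (abs_le.1 (Real.abs_exp_sub_one_sub_id_le ht)).2
    have h4 : -1 ≤ q * t := (abs_le.1 ht).1
    have h5 : 0 ≤ 1 + t := by nlinarith
    have h6 : |1 + t| ^ q ≤ Real.exp (q * t) := by
      rw [abs_of_nonneg h5, mul_comm q t, Real.exp_mul]
      exact Real.rpow_le_rpow h5 (by linarith [Real.add_one_le_exp t]) hq0.le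
    nlinarith [mul_nonneg h1 h2, mul_nonneg h1 (sq_nonneg t), mul_nonneg (sq_nonneg q) h2]
  · rw [not_le, abs_mul, abs_of_pos hq0] at ht
    have h3 : |1 + t| ≤ (q + 1) * |t| := by
      have := abs_add_le 1 t
      rw [abs_one] at this
      linarith
    have h4 : |1 + t| ^ q ≤ (q + 1) ^ q * |t| ^ q := by
      rw [← Real.mul_rpow (by positivity) (abs_nonneg t)]
      exact Real.rpow_le_rpow (abs_nonneg _) h3 hq0.le
    have h5 : -(q * |t|) ≤ q * t := by nlinarith [neg_abs_le t]
    have h6 : q * |t| ≤ q ^ 2 * t ^ 2 := by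
      rw [← sq_abs t]
      nlinarith [abs_nonneg t]
    nlinarith [mul_nonneg h1 (sq_nonneg t), mul_nonneg (sq_nonneg q) h2]

/-- The inequality for `1 + t`, made homogeneous with `t = z / s`. The linear term must appear
exactly, since orthogonality will remove it after integration. -/
lemma abs_add_rpow_le_taylor {q : ℝ} (hq : 2 < q) (s z : ℝ) :
    |s + z| ^ q ≤ |s| ^ q + q * (|s| ^ (q - 2) * s * z)
      + taylorConst q * (|s| ^ (q - 2) * z ^ 2 + |z| ^ q) := by
  rcases eq_or_ne s 0 with rfl | hs
  · have h := one_le_taylorConst hq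
    have h2 : 0 ≤ |z| ^ q := by positivity
    rw [abs_zero, Real.zero_rpow (by linarith), Real.zero_rpow (by linarith)]
    simp only [zero_add, zero_mul, mul_zero]
    nlinarith
  · have hs' : 0 < |s| := abs_pos.2 hs
    have h := mul_le_mul_of_nonneg_left (abs_one_add_rpow_le hq (z / s))
      (Real.rpow_nonneg (abs_nonneg s) q)
    have e1 : |s| ^ q * |1 + z / s| ^ q = |s + z| ^ q := by
      rw [← Real.mul_rpow (abs_nonneg _) (abs_nonneg _), ← abs_mul]
      congr 2
      field_simp
    have e2 : |s| ^ q * |z / s| ^ q = |z| ^ q := by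
      rw [← Real.mul_rpow (abs_nonneg _) (abs_nonneg _), ← abs_mul]
      congr 2
      field_simp
    have e3 : |s| ^ q = |s| ^ (q - 2) * s ^ 2 := by
      rw [← sq_abs s, ← Real.rpow_natCast |s| 2, ← Real.rpow_add hs']
      norm_num
    have e4 : |s| ^ q * (z / s) = |s| ^ (q - 2) * s * z := by
      rw [e3]; field_simp
    have e5 : |s| ^ q * (z / s) ^ 2 = |s| ^ (q - 2) * z ^ 2 := by
      rw [e3]; field_simp
    rw [e1] at h
    calc _ ≤ _ := h
      _ = |s| ^ q + q * (|s| ^ q * (z / s))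
          + taylorConst q * (|s| ^ q * (z / s) ^ 2 + |s| ^ q * |z / s| ^ q) := by ring
      _ = _ := by rw [e2, e4, e5]

lemma rpow_mul_rpow_le_add {a b u v q : ℝ} (ha : 0 ≤ a) (hb : 0 ≤ b) (hu : 0 ≤ u) (hv : 0 ≤ v)
    (huv : u + v = q) : a ^ u * b ^ v ≤ a ^ q + b ^ q := by
  have hmul : ∀ c : ℝ, 0 ≤ c → c ^ u * c ^ v = c ^ q := fun c hc ↦ by
    rw [← huv, Real.rpow_add_of_nonneg hc hu hv]
  have ha' := Real.rpow_nonneg ha q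
  have hb' := Real.rpow_nonneg hb q
  rcases le_total a b with h | h
  · calc a ^ u * b ^ v ≤ b ^ u * b ^ v := by gcongr
      _ ≤ _ := by rw [hmul b hb]; linarith
  · calc a ^ u * b ^ v ≤ a ^ u * a ^ v := by gcongr
      _ ≤ _ := by rw [hmul a ha]; linarith

/-- A substitute for Hölder: each variable is first divided by its own scale, `√V` or `√c`, so that
both summands on the right have bounded integral when the `q`-th moments are at most `V ^ (q / 2)`
and `c ^ (q / 2)`. -/
lemma rpow_sub_two_mul_sq_le {q s d V c : ℝ} (hq : 2 < q) (hV : 0 < V) (hc : 0 < c) :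
    |s| ^ (q - 2) * d ^ 2 ≤
      V ^ (q / 2 - 1) * c * (|s| ^ q / V ^ (q / 2) + |d| ^ q / c ^ (q / 2)) := by
  have h := rpow_mul_rpow_le_add (a := |s| / √V) (b := |d| / √c) (u := q - 2) (v := 2) (q := q)
    (by positivity) (by positivity) (by linarith) (by norm_num) (by ring)
  have hroot : ∀ x w : ℝ, 0 < x → (√x) ^ w = x ^ (w / 2) := fun x w hx ↦ by
    rw [Real.sqrt_eq_rpow, ← Real.rpow_mul hx.le]; ring_nf
  rw [Real.div_rpow (abs_nonneg _) (Real.sqrt_nonneg _),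
    Real.div_rpow (abs_nonneg _) (Real.sqrt_nonneg _),
    Real.div_rpow (abs_nonneg _) (Real.sqrt_nonneg _),
    Real.div_rpow (abs_nonneg _) (Real.sqrt_nonneg _), hroot V _ hV, hroot V _ hV, hroot c _ hc,
    hroot c _ hc] at h
  have h2 : (2 : ℝ) / 2 = 1 := by norm_num
  have h3 : (q - 2) / 2 = q / 2 - 1 := by ring
  rw [h2, h3, Real.rpow_one, Real.rpow_two, sq_abs] at h
  have hV' : 0 < V ^ (q / 2 - 1) := by positivity
  calc |s| ^ (q - 2) * d ^ 2
      = V ^ (q / 2 - 1) * c * (|s| ^ (q - 2) / V ^ (q / 2 - 1) * (d ^ 2 / c)) := by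
        field_simp
    _ ≤ _ := by gcongr

/-- Split `(a + b) ^ m = (a + b) ^ (m - 1) * (a + b)`; the factor multiplying `b` dominates both `a
^ (m - 1)` and `b ^ (m - 1)`, hence their average. -/
lemma rpow_add_ge {a b m : ℝ} (ha : 0 ≤ a) (hb : 0 ≤ b) (hm : 1 < m) :
    a ^ m + (a ^ (m - 1) * b + b ^ m) / 2 ≤ (a + b) ^ m := by
  have hmul : ∀ c : ℝ, 0 ≤ c → c ^ m = c ^ (m - 1) * c := fun c hc ↦ by
    have := Real.rpow_add_of_nonneg hc (y := m - 1) (z := 1) (by linarith) (by norm_num)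
    rw [Real.rpow_one] at this
    rw [← this]; ring_nf
  have h1 : a ^ (m - 1) ≤ (a + b) ^ (m - 1) :=
    Real.rpow_le_rpow ha (by linarith) (by linarith)
  have h2 : b ^ (m - 1) ≤ (a + b) ^ (m - 1) :=
    Real.rpow_le_rpow hb (by linarith) (by linarith)
  rw [hmul a ha, hmul b hb, hmul (a + b) (by linarith)]
  nlinarith

/-- The growth constant of the `q`-th moments of sums of orthogonal increments. -/
noncomputable def momentConst (q : ℝ) : ℝ := 4 * taylorConst q

lemma one_le_momentConst {q : ℝ} (hq : 2 < q) : 1 ≤ momentConst q := by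
  have := one_le_taylorConst hq
  unfold momentConst; linarith

/-- The recursion closes here. The factor 4 in `momentConst` pays for the 2 in the mixed term and
for the 1/2 in `rpow_add_ge`. -/
lemma momentConst_step {q V c : ℝ} (hq : 2 < q) (hV : 0 < V) (hc : 0 < c) :
    (momentConst q * V) ^ (q / 2) + taylorConst q *
      ((momentConst q * V) ^ (q / 2 - 1) * c * 2 + c ^ (q / 2))
      ≤ (momentConst q * (V + c)) ^ (q / 2) := by
  have hK := one_le_momentConst hq
  have hK0 : 0 < momentConst q := by linarith
  have h := rpow_add_ge (a := momentConst q * V) (b := momentConst q * c) (m := q / 2)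
    (by positivity) (by positivity) (by linarith)
  rw [← mul_add] at h
  refine le_trans ?_ h
  have h1 : momentConst q * c ^ (q / 2) ≤ (momentConst q * c) ^ (q / 2) := by
    rw [Real.mul_rpow hK0.le hc.le]
    gcongr
    exact Real.self_le_rpow_of_one_le hK (by linarith)
  have h2 : 0 ≤ c ^ (q / 2) := by positivity
  have h3 := one_le_taylorConst hq
  have h4 : momentConst q = 4 * taylorConst q := rfl
  generalize (momentConst q * V) ^ (q / 2 - 1) = x at *
  generalize (momentConst q * V) ^ (q / 2) = w at *
  rw [h4] at h1 ⊢
  nlinarith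

section Moments

variable {Ω : Type*} [MeasurableSpace Ω] {μ : Measure Ω}

lemma MeasureTheory.MemLp.integrable_abs_rpow {q : ℝ} {f : Ω → ℝ} (hq : 0 < q)
    (hf : MemLp f (ENNReal.ofReal q) μ) : Integrable (fun ω ↦ |f ω| ^ q) μ := by
  have := hf.integrable_norm_rpow (by simpa using hq) (by simp)
  simpa [ENNReal.toReal_ofReal hq.le] using this

lemma integrable_abs_rpow_mul_mul {q : ℝ} {S D : Ω → ℝ} (hq : 2 < q)
    (hS : MemLp S (ENNReal.ofReal q) μ) (hD : MemLp D (ENNReal.ofReal q) μ) :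
    Integrable (fun ω ↦ |S ω| ^ (q - 2) * S ω * D ω) μ := by
  have iS := hS.integrable_abs_rpow (by linarith)
  have iD := hD.integrable_abs_rpow (by linarith)
  have mS := hS.aestronglyMeasurable
  have mD := hD.aestronglyMeasurable
  have mSq : AEStronglyMeasurable (fun ω ↦ |S ω| ^ (q - 2)) μ :=
    (mS.aemeasurable.abs.pow_const _).aestronglyMeasurable
  refine (iS.add iD).mono' ((mSq.mul mS).mul mD) (Eventually.of_forall fun ω ↦ ?_)
  have h := rpow_mul_rpow_le_add (a := |S ω|) (b := |D ω|) (u := q - 1) (v := 1) (q := q)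
    (abs_nonneg _) (abs_nonneg _) (by linarith) (by norm_num) (by ring)
  have h' : |S ω| ^ (q - 1) = |S ω| ^ (q - 2) * |S ω| := by
    have := Real.rpow_add_of_nonneg (abs_nonneg (S ω)) (y := q - 2) (z := 1)
      (by linarith) (by norm_num)
    rw [Real.rpow_one] at this
    rw [← this]; ring_nf
  rw [Real.rpow_one, h'] at h
  simpa [abs_mul, abs_of_nonneg (Real.rpow_nonneg (abs_nonneg (S ω)) _)] using h

/-- One step of a Burkholder-type inequality: `|S| ^ (q - 2) * S` is, up to the factor `q`, the
derivative of `|·| ^ q` at `S`, so `horth` kills the first order term and the scale grows additively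
from `V` to `V + c`. -/
lemma integral_abs_add_rpow_le {q V c : ℝ} {S D : Ω → ℝ} (hq : 2 < q) (hV : 0 < V) (hc : 0 < c)
    (hS : MemLp S (ENNReal.ofReal q) μ) (hD : MemLp D (ENNReal.ofReal q) μ)
    (hSV : ∫ ω, |S ω| ^ q ∂μ ≤ (momentConst q * V) ^ (q / 2))
    (hDc : ∫ ω, |D ω| ^ q ∂μ ≤ c ^ (q / 2))
    (horth : ∫ ω, |S ω| ^ (q - 2) * S ω * D ω ∂μ = 0) :
    ∫ ω, |S ω + D ω| ^ q ∂μ ≤ (momentConst q * (V + c)) ^ (q / 2) := by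
  have hq0 : 0 < q := by linarith
  have hK := one_le_momentConst hq
  have hT := one_le_taylorConst hq
  set W := momentConst q * V with hW
  have hW0 : 0 < W := by positivity
  have iS := hS.integrable_abs_rpow hq0
  have iD := hD.integrable_abs_rpow hq0
  have iSD := (hS.add hD).integrable_abs_rpow hq0
  have mS := hS.aestronglyMeasurable
  have mD := hD.aestronglyMeasurable
  have mSq : AEStronglyMeasurable (fun ω ↦ |S ω| ^ (q - 2)) μ :=
    (mS.aemeasurable.abs.pow_const _).aestronglyMeasurable
  have i1 := integrable_abs_rpow_mul_mul hq hS hD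
  have i2 : Integrable (fun ω ↦ |S ω| ^ (q - 2) * D ω ^ 2) μ := by
    refine (iS.add iD).mono' (mSq.mul (mD.pow 2)) (Eventually.of_forall fun ω ↦ ?_)
    have h := rpow_mul_rpow_le_add (a := |S ω|) (b := |D ω|) (u := q - 2) (v := 2) (q := q)
      (abs_nonneg _) (abs_nonneg _) (by linarith) (by norm_num) (by ring)
    rw [Real.rpow_two, sq_abs] at h
    rwa [Real.norm_of_nonneg (by positivity)]
  have h2 : ∫ ω, |S ω| ^ (q - 2) * D ω ^ 2 ∂μ ≤ W ^ (q / 2 - 1) * c * 2 := by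
    calc _ ≤ ∫ ω, W ^ (q / 2 - 1) * c * (|S ω| ^ q / W ^ (q / 2) + |D ω| ^ q / c ^ (q / 2)) ∂μ :=
          integral_mono i2 (((iS.div_const _).add (iD.div_const _)).const_mul _)
            fun ω ↦ rpow_sub_two_mul_sq_le hq hW0 hc
      _ = W ^ (q / 2 - 1) * c *
            ((∫ ω, |S ω| ^ q ∂μ) / W ^ (q / 2) + (∫ ω, |D ω| ^ q ∂μ) / c ^ (q / 2)) := by
          rw [integral_const_mul, integral_add (iS.div_const _) (iD.div_const _),
            integral_div, integral_div]
      _ ≤ W ^ (q / 2 - 1) * c * (1 + 1) := by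
          gcongr
          · exact div_le_one_of_le₀ hSV (by positivity)
          · exact div_le_one_of_le₀ hDc (by positivity)
      _ = _ := by ring
  have i3 : Integrable (fun ω ↦ |S ω| ^ q + q * (|S ω| ^ (q - 2) * S ω * D ω)) μ :=
    iS.add (i1.const_mul q)
  have i4 : Integrable (fun ω ↦ taylorConst q * (|S ω| ^ (q - 2) * D ω ^ 2 + |D ω| ^ q)) μ :=
    (i2.add iD).const_mul _
  calc ∫ ω, |S ω + D ω| ^ q ∂μ
      ≤ ∫ ω, (|S ω| ^ q + q * (|S ω| ^ (q - 2) * S ω * D ω)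
          + taylorConst q * (|S ω| ^ (q - 2) * D ω ^ 2 + |D ω| ^ q)) ∂μ :=
        integral_mono iSD (i3.add i4)
          fun ω ↦ abs_add_rpow_le_taylor hq _ _
    _ = (∫ ω, |S ω| ^ q ∂μ) + taylorConst q *
          ((∫ ω, |S ω| ^ (q - 2) * D ω ^ 2 ∂μ) + ∫ ω, |D ω| ^ q ∂μ) := by
        rw [integral_add i3 i4,
          integral_add iS (i1.const_mul _), integral_const_mul, integral_const_mul, horth,
          integral_add i2 iD]
        ring
    _ ≤ W ^ (q / 2) + taylorConst q * (W ^ (q / 2 - 1) * c * 2 + c ^ (q / 2)) := by gcongr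
    _ ≤ _ := momentConst_step hq hV hc

end Moments

/-! ### Moments of linear and quadratic forms in independent variables -/

lemma abs_add_rpow_le {q : ℝ} (hq : 0 ≤ q) (x y : ℝ) :
    |x + y| ^ q ≤ 2 ^ q * (|x| ^ q + |y| ^ q) := by
  have h : |x + y| ≤ 2 * max |x| |y| := by
    have := abs_add_le x y
    linarith [le_max_left |x| |y|, le_max_right |x| |y|]
  calc |x + y| ^ q ≤ (2 * max |x| |y|) ^ q := by gcongr
    _ = 2 ^ q * (max |x| |y|) ^ q := Real.mul_rpow (by norm_num) (by positivity)
    _ ≤ _ := by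
      gcongr
      have hx : 0 ≤ |x| ^ q := by positivity
      have hy : 0 ≤ |y| ^ q := by positivity
      rcases max_cases |x| |y| with ⟨h, _⟩ | ⟨h, _⟩ <;> rw [h] <;> linarith

lemma abs_rpow_eq_sq_rpow (q x : ℝ) : |x| ^ q = (x ^ 2) ^ (q / 2) := by
  rw [← sq_abs, ← Real.rpow_natCast, ← Real.rpow_mul (abs_nonneg x)]
  congr 1
  push_cast
  ring

lemma rpow_two_div_rpow {q x : ℝ} (hq : 0 < q) (hx : 0 ≤ x) : (x ^ (2 / q)) ^ (q / 2) = x := by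
  rw [← Real.rpow_mul hx]
  have : 2 / q * (q / 2) = 1 := by field_simp
  rw [this, Real.rpow_one]

section Forms

variable {Ω ι : Type*} [MeasurableSpace Ω] {μ : Measure Ω} {e : ι → Ω → ℝ}

lemma MeasureTheory.MemLp.of_integrable_abs_rpow {q : ℝ} {f : Ω → ℝ} (hq : 0 < q)
    (hm : AEStronglyMeasurable f μ) (hf : Integrable (fun ω ↦ |f ω| ^ q) μ) :
    MemLp f (ENNReal.ofReal q) μ := by
  refine (integrable_norm_rpow_iff hm (by simpa using hq) (by simp)).1 ?_
  simpa [ENNReal.toReal_ofReal hq.le] using hf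

lemma ProbabilityTheory.iIndepFun.indepFun_past (hind : iIndepFun e μ)
    (hm : ∀ i, Measurable (e i)) {s : Finset ι} {k : ι} (hk : k ∉ s) :
    IndepFun (fun ω (i : s) ↦ e i ω) (e k) μ := by
  have h := hind.indepFun_finset s {k} (by simpa using hk) hm
  exact h.comp (φ := id) (ψ := fun x : ({k} : Finset ι) → ℝ ↦ x ⟨k, by simp⟩) measurable_id
    (measurable_pi_apply _)

lemma ProbabilityTheory.iIndepFun.indepFun_comp_past (hind : iIndepFun e μ)
    (hm : ∀ i, Measurable (e i)) {s : Finset ι} {k : ι} (hk : k ∉ s) {φ : (s → ℝ) → ℝ}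
    {ψ : ℝ → ℝ} (hφ : Measurable φ) (hψ : Measurable ψ) :
    IndepFun (fun ω ↦ φ fun i ↦ e i ω) (fun ω ↦ ψ (e k ω)) μ :=
  (hind.indepFun_past hm hk).comp hφ hψ

/-- A function of the variables in `s` times a centred function of another one has mean zero. -/
lemma ProbabilityTheory.iIndepFun.integral_past_mul_eq_zero (hind : iIndepFun e μ)
    (hm : ∀ i, Measurable (e i)) {s : Finset ι} {k : ι} (hk : k ∉ s) {φ : (s → ℝ) → ℝ}
    {ψ : ℝ → ℝ} (hφ : Measurable φ) (hψ : Measurable ψ) (h0 : ∫ ω, ψ (e k ω) ∂μ = 0) :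
    ∫ ω, φ (fun i ↦ e i ω) * ψ (e k ω) ∂μ = 0 := by
  rw [(hind.indepFun_comp_past hm hk hφ hψ).integral_fun_mul_eq_mul_integral
    (hφ.comp (measurable_pi_lambda _ fun i ↦ hm i)).aestronglyMeasurable
    (hψ.comp (hm k)).aestronglyMeasurable, h0, mul_zero]

variable {q M : ℝ}

lemma memLp_linear_form (hL : ∀ i, MemLp (e i) (ENNReal.ofReal q) μ) (a : ι → ℝ) (s : Finset ι) :
    MemLp (fun ω ↦ ∑ i ∈ s, a i * e i ω) (ENNReal.ofReal q) μ :=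
  memLp_finsetSum s fun i _ ↦ (hL i).const_mul (a i)

/-- Induction on `s` with the one-step inequality. The majorants `w i` and the summand 1 keep all
scales strictly positive, as that inequality demands, even when coefficients vanish or `s` is empty.
-/
lemma integral_abs_linear_form_le (hq : 2 < q) (hind : iIndepFun e μ)
    (hm : ∀ i, Measurable (e i)) (hL : ∀ i, MemLp (e i) (ENNReal.ofReal q) μ)
    (h0 : ∀ i, ∫ ω, e i ω ∂μ = 0) (hM : 0 < M) (hMq : ∀ i, ∫ ω, |e i ω| ^ q ∂μ ≤ M ^ (q / 2))
    (a w : ι → ℝ) (hw : ∀ i, 0 < w i) (haw : ∀ i, a i ^ 2 ≤ w i) (s : Finset ι) :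
    ∫ ω, |∑ i ∈ s, a i * e i ω| ^ q ∂μ
      ≤ (momentConst q * (M * (1 + ∑ i ∈ s, w i))) ^ (q / 2) := by
  classical
  have hK := one_le_momentConst hq
  induction s using Finset.induction_on with
  | empty =>
    simp only [Finset.sum_empty, abs_zero, Real.zero_rpow (by linarith : q ≠ 0), integral_zero]
    positivity
  | insert k s hk ih =>
    simp only [Finset.sum_insert hk]
    have hsum : 0 ≤ ∑ i ∈ s, w i := Finset.sum_nonneg fun i _ ↦ (hw i).le
    have := integral_abs_add_rpow_le (c := M * w k) hq (by positivity)
      (mul_pos hM (hw k)) (memLp_linear_form hL a s) ((hL k).const_mul (a k)) ih ?_ ?_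
    · simp_rw [add_comm (a k * _)]
      refine this.trans_eq ?_
      congr 1
      ring
    · simp_rw [abs_mul, Real.mul_rpow (abs_nonneg _) (abs_nonneg _)]
      rw [integral_const_mul, Real.mul_rpow hM.le (hw k).le, mul_comm (M ^ _)]
      have hw' : 0 ≤ w k := (hw k).le
      refine mul_le_mul ?_ (hMq k) (integral_nonneg fun ω ↦ by positivity) (by positivity)
      exact (abs_rpow_eq_sq_rpow q (a k)).le.trans
        (Real.rpow_le_rpow (sq_nonneg _) (haw k) (by linarith))
    · have h := hind.integral_past_mul_eq_zero hm hk
        (φ := fun x ↦ |∑ i : s, a i * x i| ^ (q - 2) * ∑ i : s, a i * x i)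
        (ψ := fun x ↦ a k * x) (by fun_prop) (by fun_prop)
        (by rw [integral_const_mul, h0, mul_zero])
      convert h using 4 with ω
      rw [← Finset.sum_coe_sort s fun i ↦ a i * e i ω]

/-- The centred quadratic form `∑ i j ∈ s, B i j e i e j - v ∑ i ∈ s, B i i`. -/
noncomputable def centredForm (B : Matrix ι ι ℝ) (v : ℝ) (s : Finset ι) (x : ι → ℝ) : ℝ :=
  ∑ i ∈ s, ∑ j ∈ s, B i j * x i * x j - v * ∑ i ∈ s, B i i

/-- By symmetry the new row and column merge into one cross term. Both parts of the increment are
centred given the variables in `s` when `x k` has mean zero and second moment `v`. -/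
lemma centredForm_insert [DecidableEq ι] {B : Matrix ι ι ℝ} (hB : B.IsSymm) (v : ℝ)
    {s : Finset ι} {k : ι} (hk : k ∉ s) (x : ι → ℝ) :
    centredForm B v (insert k s) x = centredForm B v s x +
      (B k k * (x k ^ 2 - v) + (∑ j ∈ s, 2 * B k j * x j) * x k) := by
  simp only [centredForm, Finset.sum_insert hk, Finset.sum_add_distrib]
  have h1 : ∑ i ∈ s, B i k * x i * x k = (∑ j ∈ s, B k j * x j) * x k := by
    rw [Finset.sum_mul]
    exact Finset.sum_congr rfl fun i _ ↦ by rw [hB.apply k i]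
  have h2 : ∑ j ∈ s, B k j * x k * x j = (∑ j ∈ s, B k j * x j) * x k := by
    rw [Finset.sum_mul]
    exact Finset.sum_congr rfl fun i _ ↦ by ring
  have h3 : ∑ j ∈ s, 2 * B k j * x j = 2 * ∑ j ∈ s, B k j * x j := by
    rw [Finset.mul_sum]
    exact Finset.sum_congr rfl fun i _ ↦ by ring
  rw [h1, h2, h3]
  ring

/-- The bound for the `q`-th moment of a single increment of a quadratic form. -/
noncomputable def incrementConst (q κ M N : ℝ) : ℝ :=
  2 ^ q * (κ ^ (q / 2) * N + M ^ (q / 2) * (momentConst q * (M * (1 + 4 * (κ + 1)))) ^ (q / 2))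

/-- The growth constant of the `q`-th moments of quadratic forms. -/
noncomputable def formConst (q κ M N : ℝ) : ℝ :=
  momentConst q * (incrementConst q κ M N) ^ (2 / q)

lemma incrementConst_pos {κ N : ℝ} (hq : 2 < q) (hκ : 0 ≤ κ) (hM : 0 < M) (hN : 0 ≤ N) :
    0 < incrementConst q κ M N := by
  have := one_le_momentConst hq
  unfold incrementConst
  positivity

lemma formConst_pos {κ N : ℝ} (hq : 2 < q) (hκ : 0 ≤ κ) (hM : 0 < M) (hN : 0 ≤ N) :
    0 < formConst q κ M N := by
  have := one_le_momentConst hq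
  have := incrementConst_pos hq hκ hM hN
  unfold formConst
  positivity

variable [Fintype ι]

/-- The cross term is a product of independent factors, so its `q`-th moment factors and the linear
form bound applies to row `k`. Only the diagonal term needs moments of the square. -/
lemma memLp_and_integral_increment_le {κ N v : ℝ} (hq : 2 < q) (hind : iIndepFun e μ)
    (hm : ∀ i, Measurable (e i)) (hL : ∀ i, MemLp (e i) (ENNReal.ofReal q) μ)
    (hL2 : ∀ i, MemLp (fun ω ↦ e i ω ^ 2 - v) (ENNReal.ofReal q) μ)
    (h0 : ∀ i, ∫ ω, e i ω ∂μ = 0) (hM : 0 < M) (hMq : ∀ i, ∫ ω, |e i ω| ^ q ∂μ ≤ M ^ (q / 2))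
    (hNq : ∀ i, ∫ ω, |e i ω ^ 2 - v| ^ q ∂μ ≤ N)
    {B : Matrix ι ι ℝ} (hB : ∀ i, ∑ j, B i j ^ 2 ≤ κ) {s : Finset ι} {k : ι} (hk : k ∉ s) :
    MemLp (fun ω ↦ (∑ j ∈ s, 2 * B k j * e j ω) * e k ω) (ENNReal.ofReal q) μ ∧
    ∫ ω, |B k k * (e k ω ^ 2 - v) + (∑ j ∈ s, 2 * B k j * e j ω) * e k ω| ^ q ∂μ
      ≤ incrementConst q κ M N := by
  have hq0 : 0 < q := by linarith
  have hK := one_le_momentConst hq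
  have hκ : 0 ≤ κ := (Finset.sum_nonneg fun j _ ↦ sq_nonneg (B k j)).trans (hB k)
  have hcard : (0 : ℝ) < Fintype.card ι := by
    exact_mod_cast Fintype.card_pos_iff.2 ⟨k⟩
  have memL := memLp_linear_form hL (fun j ↦ 2 * B k j) s
  have hlin := integral_abs_linear_form_le hq hind hm hL h0 hM hMq (fun j ↦ 2 * B k j)
    -- Adding `1 / card` makes the majorant positive at a total cost of 1, independent of the
    -- dimension.
    (fun j ↦ 4 * (B k j ^ 2 + 1 / Fintype.card ι)) (fun j ↦ by positivity)
    (fun j ↦ by have : (0 : ℝ) < 1 / Fintype.card ι := by positivity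
                nlinarith) s
  have hwsum : ∑ j ∈ s, 4 * (B k j ^ 2 + 1 / (Fintype.card ι : ℝ)) ≤ 4 * (κ + 1) := by
    calc _ ≤ ∑ j, 4 * (B k j ^ 2 + 1 / (Fintype.card ι : ℝ)) :=
          Finset.sum_le_sum_of_subset_of_nonneg (Finset.subset_univ _)
            fun j _ _ ↦ by positivity
      _ = 4 * (∑ j, B k j ^ 2 + 1) := by
          rw [← Finset.mul_sum, Finset.sum_add_distrib, Finset.sum_const, Finset.card_univ,
            nsmul_eq_mul, mul_one_div_cancel hcard.ne']
      _ ≤ _ := by gcongr; exact hB k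
  have hindLq : IndepFun (fun ω ↦ |∑ j ∈ s, 2 * B k j * e j ω| ^ q) (fun ω ↦ |e k ω| ^ q) μ := by
    have h := hind.indepFun_comp_past hm hk (φ := fun x ↦ |∑ j : s, 2 * B k j * x j| ^ q)
      (ψ := fun x ↦ |x| ^ q) (by fun_prop) (by fun_prop)
    convert h using 4 with ω
    rw [← Finset.sum_coe_sort s fun j ↦ 2 * B k j * e j ω]
  have iL := memL.integrable_abs_rpow hq0
  have ie := (hL k).integrable_abs_rpow hq0
  have iprod : Integrable (fun ω ↦ |(∑ j ∈ s, 2 * B k j * e j ω) * e k ω| ^ q) μ := by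
    refine (hindLq.integrable_mul iL ie).congr (Eventually.of_forall fun ω ↦ ?_)
    simp only [Pi.mul_apply]
    rw [abs_mul, Real.mul_rpow (abs_nonneg _) (abs_nonneg _)]
  have mprod : MemLp (fun ω ↦ (∑ j ∈ s, 2 * B k j * e j ω) * e k ω) (ENNReal.ofReal q) μ :=
    MemLp.of_integrable_abs_rpow hq0
      (memL.aestronglyMeasurable.mul (hL k).aestronglyMeasurable) iprod
  refine ⟨mprod, ?_⟩
  have msq := (hL2 k).const_mul (B k k)
  have isq := msq.integrable_abs_rpow hq0
  have h1 : ∫ ω, |B k k * (e k ω ^ 2 - v)| ^ q ∂μ ≤ κ ^ (q / 2) * N := by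
    simp_rw [abs_mul, Real.mul_rpow (abs_nonneg _) (abs_nonneg _)]
    rw [integral_const_mul]
    refine mul_le_mul ?_ (hNq k) (integral_nonneg fun ω ↦ by positivity) (by positivity)
    rw [abs_rpow_eq_sq_rpow]
    gcongr
    exact (Finset.single_le_sum (f := fun j ↦ B k j ^ 2) (fun j _ ↦ sq_nonneg _)
      (Finset.mem_univ k)).trans (hB k)
  have h2 : ∫ ω, |(∑ j ∈ s, 2 * B k j * e j ω) * e k ω| ^ q ∂μ
      ≤ M ^ (q / 2) * (momentConst q * (M * (1 + 4 * (κ + 1)))) ^ (q / 2) := by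
    simp_rw [abs_mul, Real.mul_rpow (abs_nonneg _) (abs_nonneg _)]
    rw [hindLq.integral_fun_mul_eq_mul_integral iL.aestronglyMeasurable ie.aestronglyMeasurable,
      mul_comm]
    refine mul_le_mul (hMq k) (hlin.trans ?_) (integral_nonneg fun ω ↦ by positivity)
      (by positivity)
    have : 0 ≤ ∑ j ∈ s, 4 * (B k j ^ 2 + 1 / (Fintype.card ι : ℝ)) :=
      Finset.sum_nonneg fun j _ ↦ by positivity
    gcongr
  calc _ ≤ ∫ ω, 2 ^ q * (|B k k * (e k ω ^ 2 - v)| ^ q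
            + |(∑ j ∈ s, 2 * B k j * e j ω) * e k ω| ^ q) ∂μ :=
        integral_mono ((msq.add mprod).integrable_abs_rpow hq0) ((isq.add iprod).const_mul _)
          fun ω ↦ abs_add_rpow_le hq0.le _ _
    _ = 2 ^ q * ((∫ ω, |B k k * (e k ω ^ 2 - v)| ^ q ∂μ)
            + ∫ ω, |(∑ j ∈ s, 2 * B k j * e j ω) * e k ω| ^ q ∂μ) := by
        rw [integral_const_mul, integral_add isq iprod]
    _ ≤ _ := by unfold incrementConst; gcongr

/-- The `q`-th central moment of a quadratic form with bounded rows is of order `n ^ (q / 2)`. -/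
theorem integral_abs_centredForm_le [IsFiniteMeasure μ] {κ N v : ℝ} (hq : 2 < q)
    (hind : iIndepFun e μ)
    (hm : ∀ i, Measurable (e i)) (hL : ∀ i, MemLp (e i) (ENNReal.ofReal q) μ)
    (hL2 : ∀ i, MemLp (fun ω ↦ e i ω ^ 2 - v) (ENNReal.ofReal q) μ)
    (h0 : ∀ i, ∫ ω, e i ω ∂μ = 0) (hv : ∀ i, ∫ ω, (e i ω ^ 2 - v) ∂μ = 0)
    (hM : 0 < M) (hMq : ∀ i, ∫ ω, |e i ω| ^ q ∂μ ≤ M ^ (q / 2))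
    (hN : 0 ≤ N) (hNq : ∀ i, ∫ ω, |e i ω ^ 2 - v| ^ q ∂μ ≤ N)
    {B : Matrix ι ι ℝ} (hsymm : B.IsSymm) (hκ : 0 ≤ κ) (hB : ∀ i, ∑ j, B i j ^ 2 ≤ κ)
    (s : Finset ι) :
    MemLp (fun ω ↦ centredForm B v s fun i ↦ e i ω) (ENNReal.ofReal q) μ ∧
    ∫ ω, |centredForm B v s fun i ↦ e i ω| ^ q ∂μ
      ≤ (formConst q κ M N * (1 + s.card)) ^ (q / 2) := by
  classical
  have hq0 : 0 < q := by linarith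
  have hK := one_le_momentConst hq
  have hI := incrementConst_pos hq hκ hM hN
  induction s using Finset.induction_on with
  | empty =>
    refine ⟨by simp [centredForm], ?_⟩
    have := formConst_pos hq hκ hM hN
    simp only [centredForm, Finset.sum_empty, mul_zero, sub_zero, abs_zero,
      Real.zero_rpow hq0.ne', integral_zero]
    positivity
  | insert k s hk ih =>
    obtain ⟨ih1, ih2⟩ := ih
    obtain ⟨m1, hD⟩ := memLp_and_integral_increment_le hq hind hm hL hL2 h0 hM hMq hNq hB hk
    have m2 := (hL2 k).const_mul (B k k)
    simp only [centredForm_insert hsymm v hk]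
    refine ⟨ih1.add (m2.add m1), ?_⟩
    -- Put the increment bound in the form `c ^ (q / 2)`, so that every new variable adds the same
    -- scale `c`.
    rw [← rpow_two_div_rpow hq0 hI.le] at hD
    have := integral_abs_add_rpow_le
      (V := incrementConst q κ M N ^ (2 / q) * (1 + s.card)) hq
      (by positivity) (by positivity) ih1 (m2.add m1) ?_ hD ?_
    · refine this.trans_eq ?_
      congr 1
      rw [formConst, Finset.card_insert_of_notMem hk]
      push_cast
      ring
    · rw [← mul_assoc]
      exact ih2
    · have i1 := integrable_abs_rpow_mul_mul hq ih1 m2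
      have i2 := integrable_abs_rpow_mul_mul hq ih1 m1
      set F : (s → ℝ) → ℝ := fun x ↦
        ∑ i : s, ∑ j : s, B i j * x i * x j - v * ∑ i : s, B i i with hF
      have hFm : Measurable F := by fun_prop
      have hFe : ∀ ω, centredForm B v s (fun i ↦ e i ω) = F fun i ↦ e i ω := fun ω ↦ by
        simp only [centredForm, hF]
        rw [← Finset.sum_coe_sort s, ← Finset.sum_coe_sort s]
        simp_rw [← Finset.sum_coe_sort s fun j ↦ B _ j * e _ ω * e j ω]
      have z1 := hind.integral_past_mul_eq_zero hm hk (φ := fun x ↦ |F x| ^ (q - 2) * F x)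
        (ψ := fun x ↦ B k k * (x ^ 2 - v)) (by fun_prop) (by fun_prop)
        (by rw [integral_const_mul, hv, mul_zero])
      -- The linear form of the cross term also belongs to the past; only the last factor `e k` is
      -- centred.
      have z2 := hind.integral_past_mul_eq_zero hm hk
        (φ := fun x ↦ |F x| ^ (q - 2) * F x * ∑ j : s, 2 * B k j * x j)
        (ψ := fun x ↦ x) (by fun_prop) (by fun_prop) (h0 k)
      simp only [Pi.add_apply, mul_add]
      rw [integral_add i1 i2]
      simp only [hFe]
      rw [z1, zero_add, ← z2]
      refine integral_congr_ae (Eventually.of_forall fun ω ↦ ?_)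
      simp only
      rw [← Finset.sum_coe_sort s]
      ring

end Forms

/-! ### The resolvent of `X Xᵀ` -/

instance Matrix.instBorelSpaceEntrywise {n p : ℕ} : BorelSpace (Matrix (Fin n) (Fin p) ℝ) :=
  inferInstanceAs (BorelSpace (Fin n → Fin p → ℝ))

section Resolvent

variable {n p : ℕ}

/-- The regularized Gram matrix `X Xᵀ + λ I`. -/
noncomputable def ridgeGram (X : Matrix (Fin n) (Fin p) ℝ) (lam : ℝ) :
    Matrix (Fin n) (Fin n) ℝ :=
  X * Xᵀ + lam • (1 : Matrix (Fin n) (Fin n) ℝ)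

/-- The resolvent `(X Xᵀ + λ I)⁻¹`. -/
noncomputable def ridgeResolvent (X : Matrix (Fin n) (Fin p) ℝ) (lam : ℝ) :
    Matrix (Fin n) (Fin n) ℝ :=
  (ridgeGram X lam)⁻¹

/-- The matrix `Xᵀ (X Xᵀ + λ I)⁻² X` of the quadratic form in the signal. -/
noncomputable def signalMatrix (X : Matrix (Fin n) (Fin p) ℝ) (lam : ℝ) :
    Matrix (Fin p) (Fin p) ℝ :=
  Xᵀ * (ridgeResolvent X lam * ridgeResolvent X lam) * X

variable {X : Matrix (Fin n) (Fin p) ℝ} {lam : ℝ}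

lemma isUnit_det_ridgeGram (X : Matrix (Fin n) (Fin p) ℝ) (hlam : 0 < lam) :
    IsUnit (ridgeGram X lam).det := by
  have h1 : (X * Xᵀ).PosSemidef := by
    simpa using Matrix.posSemidef_self_mul_conjTranspose X
  have h2 : (lam • (1 : Matrix (Fin n) (Fin n) ℝ)).PosDef := Matrix.PosDef.one.smul hlam
  exact (Matrix.isUnit_iff_isUnit_det _).1 (Matrix.PosDef.posSemidef_add h1 h2).isUnit

lemma isUnit_det_transpose_mul_self_add (X : Matrix (Fin n) (Fin p) ℝ) (hlam : 0 < lam) :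
    IsUnit (Xᵀ * X + lam • (1 : Matrix (Fin p) (Fin p) ℝ)).det := by
  simpa [ridgeGram] using isUnit_det_ridgeGram Xᵀ hlam

lemma ridgeGram_mul_ridgeResolvent (X : Matrix (Fin n) (Fin p) ℝ) (hlam : 0 < lam) :
    ridgeGram X lam * ridgeResolvent X lam = 1 :=
  Matrix.mul_nonsing_inv _ (isUnit_det_ridgeGram X hlam)

lemma ridgeResolvent_mul_ridgeGram (X : Matrix (Fin n) (Fin p) ℝ) (hlam : 0 < lam) :
    ridgeResolvent X lam * ridgeGram X lam = 1 :=
  Matrix.nonsing_inv_mul _ (isUnit_det_ridgeGram X hlam)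

lemma ridgeResolvent_isSymm (X : Matrix (Fin n) (Fin p) ℝ) (lam : ℝ) :
    (ridgeResolvent X lam).IsSymm := by
  have : (ridgeGram X lam)ᵀ = ridgeGram X lam := by simp [ridgeGram]
  rw [Matrix.IsSymm, ridgeResolvent, Matrix.transpose_nonsing_inv, this]

lemma ridgeResolvent_sq_isSymm (X : Matrix (Fin n) (Fin p) ℝ) (lam : ℝ) :
    (ridgeResolvent X lam * ridgeResolvent X lam).IsSymm := by
  rw [Matrix.IsSymm, Matrix.transpose_mul, (ridgeResolvent_isSymm X lam).eq]

lemma signalMatrix_isSymm (X : Matrix (Fin n) (Fin p) ℝ) (lam : ℝ) :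
    (signalMatrix X lam).IsSymm := by
  simp only [Matrix.IsSymm, signalMatrix, Matrix.transpose_mul, Matrix.transpose_transpose,
    (ridgeResolvent_isSymm X lam).eq, Matrix.mul_assoc]

/-- Push-through: `X (Xᵀ X + λ) = (X Xᵀ + λ) X`, so the smoother is `R X Xᵀ = R (R⁻¹ - λ)`. -/
lemma one_sub_ridgeSmoother (X : Matrix (Fin n) (Fin p) ℝ) (hlam : 0 < lam) :
    1 - ridgeSmoother X lam = lam • ridgeResolvent X lam := by
  set H := Xᵀ * X + lam • (1 : Matrix (Fin p) (Fin p) ℝ) with hH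
  have hHi : H * H⁻¹ = 1 := Matrix.mul_nonsing_inv _ (isUnit_det_transpose_mul_self_add X hlam)
  have hcomm : ridgeGram X lam * X = X * H := by
    simp [ridgeGram, hH, Matrix.add_mul, Matrix.mul_add, Matrix.mul_assoc]
  have h1 : X * H⁻¹ = ridgeResolvent X lam * X := by
    calc X * H⁻¹ = (ridgeResolvent X lam * ridgeGram X lam) * (X * H⁻¹) := by
          rw [ridgeResolvent_mul_ridgeGram X hlam, Matrix.one_mul]
      _ = ridgeResolvent X lam * ((ridgeGram X lam * X) * H⁻¹) := by
          simp only [Matrix.mul_assoc]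
      _ = _ := by rw [hcomm, Matrix.mul_assoc, hHi, Matrix.mul_one]
  have h2 : X * Xᵀ = ridgeGram X lam - lam • (1 : Matrix (Fin n) (Fin n) ℝ) := by
    simp [ridgeGram]
  rw [ridgeSmoother, h1, Matrix.mul_assoc, h2, Matrix.mul_sub,
    ridgeResolvent_mul_ridgeGram X hlam]
  simp

lemma trainingError_eq (X : Matrix (Fin n) (Fin p) ℝ) (hlam : 0 < lam) (b : Fin p → ℝ)
    (x : Fin n → ℝ) :
    trainingError X (X *ᵥ b + x) lam = lam ^ 2 * (1 / n) *
      (b ⬝ᵥ (signalMatrix X lam *ᵥ b)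
        + 2 * ((ridgeResolvent X lam * ridgeResolvent X lam) *ᵥ (X *ᵥ b) ⬝ᵥ x)
        + x ⬝ᵥ ((ridgeResolvent X lam * ridgeResolvent X lam) *ᵥ x)) := by
  set B := ridgeResolvent X lam * ridgeResolvent X lam with hB
  have hBs : Bᵀ = B := (ridgeResolvent_sq_isSymm X lam).eq
  have h1 : (X *ᵥ b) ⬝ᵥ (B *ᵥ (X *ᵥ b)) = b ⬝ᵥ (signalMatrix X lam *ᵥ b) := by
    rw [show signalMatrix X lam = Xᵀ * B * X from rfl, ← Matrix.mulVec_mulVec b (Xᵀ * B) X,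
      ← Matrix.mulVec_mulVec (X *ᵥ b) Xᵀ B,
      Matrix.dotProduct_mulVec b, Matrix.vecMul_transpose]
  have h2 : (X *ᵥ b) ⬝ᵥ (B *ᵥ x) = B *ᵥ (X *ᵥ b) ⬝ᵥ x := by
    rw [Matrix.dotProduct_mulVec, ← Matrix.mulVec_transpose, hBs]
  have h3 : x ⬝ᵥ (B *ᵥ (X *ᵥ b)) = B *ᵥ (X *ᵥ b) ⬝ᵥ x := dotProduct_comm _ _
  rw [trainingError, one_sub_ridgeSmoother X hlam, sq, Matrix.smul_mul, Matrix.mul_smul, smul_smul,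
    ← hB, Matrix.smul_mulVec, dotProduct_smul, Matrix.mulVec_add, dotProduct_add, add_dotProduct,
    add_dotProduct, h1, h2, h3, smul_eq_mul]
  ring

lemma dotProduct_self_nonneg_real {ι : Type*} [Fintype ι] (v : ι → ℝ) : 0 ≤ v ⬝ᵥ v :=
  Finset.sum_nonneg fun i _ ↦ mul_self_nonneg (v i)

lemma dotProduct_sub_smul_self {ι : Type*} [Fintype ι] (v u : ι → ℝ) (c : ℝ) :
    (v - c • u) ⬝ᵥ (v - c • u) = v ⬝ᵥ v - 2 * c * (u ⬝ᵥ v) + c ^ 2 * (u ⬝ᵥ u) := by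
  simp only [sub_dotProduct, dotProduct_sub, smul_dotProduct, dotProduct_smul, smul_eq_mul,
    dotProduct_comm v u]
  ring

/-- The energy identity of the resolvent equation. -/
lemma ridgeResolvent_energy (X : Matrix (Fin n) (Fin p) ℝ) (hlam : 0 < lam) (v : Fin n → ℝ) :
    (ridgeResolvent X lam *ᵥ v) ⬝ᵥ v =
      (Xᵀ *ᵥ (ridgeResolvent X lam *ᵥ v)) ⬝ᵥ (Xᵀ *ᵥ (ridgeResolvent X lam *ᵥ v))
        + lam * ((ridgeResolvent X lam *ᵥ v) ⬝ᵥ (ridgeResolvent X lam *ᵥ v)) := by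
  set u := ridgeResolvent X lam *ᵥ v with hu
  have hv : v = ridgeGram X lam *ᵥ u := by
    rw [hu, Matrix.mulVec_mulVec, ridgeGram_mul_ridgeResolvent X hlam, Matrix.one_mulVec]
  rw [hv, ridgeGram, Matrix.add_mulVec, dotProduct_add, ← Matrix.mulVec_mulVec,
    Matrix.dotProduct_mulVec u, ← Matrix.mulVec_transpose X u, Matrix.smul_mulVec,
    Matrix.one_mulVec, dotProduct_smul, smul_eq_mul]

/-- This says `‖R‖ ≤ 1 / λ`. Here and in the next two bounds, the energy identity is combined with
the nonnegativity of a suitable square, so the constants do not involve the size of `X`. -/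
lemma ridgeResolvent_mulVec_sq_le (X : Matrix (Fin n) (Fin p) ℝ) (hlam : 0 < lam)
    (v : Fin n → ℝ) :
    lam ^ 2 * ((ridgeResolvent X lam *ᵥ v) ⬝ᵥ (ridgeResolvent X lam *ᵥ v)) ≤ v ⬝ᵥ v := by
  have h := ridgeResolvent_energy X hlam v
  have h1 := dotProduct_self_nonneg_real (Xᵀ *ᵥ (ridgeResolvent X lam *ᵥ v))
  have h2 := dotProduct_self_nonneg_real (v - lam • (ridgeResolvent X lam *ᵥ v))
  rw [dotProduct_sub_smul_self] at h2
  nlinarith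

lemma transpose_ridgeResolvent_mulVec_sq_le (X : Matrix (Fin n) (Fin p) ℝ) (hlam : 0 < lam)
    (v : Fin n → ℝ) :
    lam * ((Xᵀ *ᵥ (ridgeResolvent X lam *ᵥ v)) ⬝ᵥ (Xᵀ *ᵥ (ridgeResolvent X lam *ᵥ v)))
      ≤ v ⬝ᵥ v := by
  have h := ridgeResolvent_energy X hlam v
  have h0 := dotProduct_self_nonneg_real v
  have h2 := dotProduct_self_nonneg_real (v - (2 * lam) • (ridgeResolvent X lam *ᵥ v))
  rw [dotProduct_sub_smul_self] at h2
  nlinarith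

lemma ridgeResolvent_design_mulVec_sq_le (X : Matrix (Fin n) (Fin p) ℝ) (hlam : 0 < lam)
    (w : Fin p → ℝ) :
    lam * ((ridgeResolvent X lam *ᵥ (X *ᵥ w)) ⬝ᵥ (ridgeResolvent X lam *ᵥ (X *ᵥ w)))
      ≤ w ⬝ᵥ w := by
  have h := ridgeResolvent_energy X hlam (X *ᵥ w)
  have h0 := dotProduct_self_nonneg_real w
  set u := ridgeResolvent X lam *ᵥ (X *ᵥ w)
  have h1 : u ⬝ᵥ (X *ᵥ w) = (Xᵀ *ᵥ u) ⬝ᵥ w := by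
    rw [Matrix.dotProduct_mulVec, ← Matrix.mulVec_transpose]
  -- The coefficient 2 cancels `|Xᵀ u|²` exactly, leaving `4 λ |u|² ≤ |w|²`.
  have h2 := dotProduct_self_nonneg_real (w - (2 : ℝ) • (Xᵀ *ᵥ u))
  rw [dotProduct_sub_smul_self] at h2
  nlinarith

lemma ridgeResolvent_sq_mulVec_sq_le (X : Matrix (Fin n) (Fin p) ℝ) (hlam : 0 < lam)
    (v : Fin n → ℝ) :
    ((ridgeResolvent X lam * ridgeResolvent X lam) *ᵥ v) ⬝ᵥ
      ((ridgeResolvent X lam * ridgeResolvent X lam) *ᵥ v) ≤ (lam ^ 4)⁻¹ * (v ⬝ᵥ v) := by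
  have h1 := ridgeResolvent_mulVec_sq_le X hlam v
  have h2 := ridgeResolvent_mulVec_sq_le X hlam (ridgeResolvent X lam *ᵥ v)
  rw [← Matrix.mulVec_mulVec, ← div_eq_inv_mul, le_div_iff₀ (by positivity)]
  nlinarith [sq_nonneg lam]

lemma ridgeResolvent_sq_design_mulVec_sq_le (X : Matrix (Fin n) (Fin p) ℝ) (hlam : 0 < lam)
    (w : Fin p → ℝ) :
    ((ridgeResolvent X lam * ridgeResolvent X lam) *ᵥ (X *ᵥ w)) ⬝ᵥ
      ((ridgeResolvent X lam * ridgeResolvent X lam) *ᵥ (X *ᵥ w)) ≤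
        (lam ^ 3)⁻¹ * (w ⬝ᵥ w) := by
  have h1 := ridgeResolvent_design_mulVec_sq_le X hlam w
  have h2 := ridgeResolvent_mulVec_sq_le X hlam (ridgeResolvent X lam *ᵥ (X *ᵥ w))
  rw [← Matrix.mulVec_mulVec, ← div_eq_inv_mul, le_div_iff₀ (by positivity)]
  nlinarith

lemma signalMatrix_mulVec_sq_le (X : Matrix (Fin n) (Fin p) ℝ) (hlam : 0 < lam)
    (w : Fin p → ℝ) :
    (signalMatrix X lam *ᵥ w) ⬝ᵥ (signalMatrix X lam *ᵥ w) ≤ (lam ^ 2)⁻¹ * (w ⬝ᵥ w) := by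
  have h1 := ridgeResolvent_design_mulVec_sq_le X hlam w
  have h2 := transpose_ridgeResolvent_mulVec_sq_le X hlam (ridgeResolvent X lam *ᵥ (X *ᵥ w))
  rw [signalMatrix, ← Matrix.mulVec_mulVec, ← Matrix.mulVec_mulVec, ← Matrix.mulVec_mulVec,
    ← div_eq_inv_mul, le_div_iff₀ (by positivity)]
  nlinarith

/-- Apply the norm bound to a basis vector: it selects a column, which by symmetry is a row. -/
lemma Matrix.IsSymm.sum_row_sq_le {ι : Type*} [Fintype ι] {M : Matrix ι ι ℝ} (hM : M.IsSymm)
    {κ : ℝ} (h : ∀ w, (M *ᵥ w) ⬝ᵥ (M *ᵥ w) ≤ κ * (w ⬝ᵥ w)) (i : ι) :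
    ∑ j, M i j ^ 2 ≤ κ := by
  classical
  have := h (Pi.single i 1)
  rw [Matrix.mulVec_single_one, single_one_dotProduct, Pi.single_eq_same, mul_one] at this
  refine le_trans (le_of_eq (Finset.sum_congr rfl fun j _ ↦ ?_)) this
  rw [Matrix.col_apply, hM.apply, sq]

lemma sum_row_ridgeResolvent_sq_le (X : Matrix (Fin n) (Fin p) ℝ) (hlam : 0 < lam) (i : Fin n) :
    ∑ j, (ridgeResolvent X lam * ridgeResolvent X lam) i j ^ 2 ≤ (lam ^ 4)⁻¹ :=
  (ridgeResolvent_sq_isSymm X lam).sum_row_sq_le (ridgeResolvent_sq_mulVec_sq_le X hlam) i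

lemma sum_row_signalMatrix_sq_le (X : Matrix (Fin n) (Fin p) ℝ) (hlam : 0 < lam) (i : Fin p) :
    ∑ j, signalMatrix X lam i j ^ 2 ≤ (lam ^ 2)⁻¹ :=
  (signalMatrix_isSymm X lam).sum_row_sq_le (signalMatrix_mulVec_sq_le X hlam) i

lemma abs_trace_signalMatrix_le (X : Matrix (Fin n) (Fin p) ℝ) (hlam : 0 < lam) :
    |(signalMatrix X lam).trace| ≤ p * lam⁻¹ := by
  calc |(signalMatrix X lam).trace| ≤ ∑ i, |signalMatrix X lam i i| :=
        Finset.abs_sum_le_sum_abs _ _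
    _ ≤ ∑ _i : Fin p, lam⁻¹ := Finset.sum_le_sum fun i _ ↦ by
        refine abs_le_of_sq_le_sq ?_ (by positivity)
        rw [inv_pow]
        exact (Finset.single_le_sum (f := fun j ↦ signalMatrix X lam i j ^ 2)
          (fun j _ ↦ sq_nonneg _) (Finset.mem_univ i)).trans (sum_row_signalMatrix_sq_le X hlam i)
    _ = _ := by simp

/-- Cyclicity of the trace and `X Xᵀ = R⁻¹ - λ`. This is the source of the combination `v_D - λ
v_D'`. -/
lemma trace_signalMatrix (X : Matrix (Fin n) (Fin p) ℝ) (hlam : 0 < lam) :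
    (signalMatrix X lam).trace = (ridgeResolvent X lam).trace
      - lam * (ridgeResolvent X lam * ridgeResolvent X lam).trace := by
  have h : X * Xᵀ = ridgeGram X lam - lam • (1 : Matrix (Fin n) (Fin n) ℝ) := by
    simp [ridgeGram]
  rw [signalMatrix, Matrix.mul_assoc, Matrix.trace_mul_comm, Matrix.mul_assoc, h, Matrix.mul_sub,
    Matrix.mul_assoc, ridgeResolvent_mul_ridgeGram X hlam, Matrix.trace_sub, Matrix.mul_smul,
    Matrix.mul_one, Matrix.mul_one, Matrix.trace_smul, smul_eq_mul]

lemma trace_conjStarAlgAut {ι : Type*} [Fintype ι] [DecidableEq ι]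
    (U : Matrix.unitaryGroup ι ℝ) (M : Matrix ι ι ℝ) :
    (Unitary.conjStarAlgAut ℝ _ U M).trace = M.trace := by
  rw [Unitary.conjStarAlgAut_apply, Matrix.trace_mul_cycle, Unitary.coe_star_mul_self,
    Matrix.one_mul]

lemma ridgeResolvent_eq_conj (X : Matrix (Fin n) (Fin p) ℝ) (hlam : 0 < lam) :
    ridgeResolvent X lam = Unitary.conjStarAlgAut ℝ _
      (Matrix.isHermitian_mul_conjTranspose_self X).eigenvectorUnitary
      (Matrix.diagonal fun i ↦
        ((Matrix.isHermitian_mul_conjTranspose_self X).eigenvalues i + lam)⁻¹) := by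
  set hH := Matrix.isHermitian_mul_conjTranspose_self X
  have hpos : ∀ i, 0 ≤ hH.eigenvalues i :=
    (Matrix.posSemidef_self_mul_conjTranspose X).eigenvalues_nonneg
  have hR : ridgeGram X lam = Unitary.conjStarAlgAut ℝ _ hH.eigenvectorUnitary
      (Matrix.diagonal fun i ↦ hH.eigenvalues i + lam) := by
    have h1 : (Matrix.diagonal fun i ↦ hH.eigenvalues i + lam) =
        Matrix.diagonal hH.eigenvalues + lam • (1 : Matrix (Fin n) (Fin n) ℝ) := by
      rw [Matrix.smul_one_eq_diagonal, Matrix.diagonal_add]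
    rw [h1, map_add, map_smul, map_one, ridgeGram]
    congr 1
    have := hH.spectral_theorem
    rw [← Matrix.conjTranspose_eq_transpose_of_trivial]
    exact this
  rw [ridgeResolvent]
  refine Matrix.inv_eq_right_inv ?_
  rw [hR, ← map_mul, Matrix.diagonal_mul_diagonal]
  have : (fun i ↦ (hH.eigenvalues i + lam) * (hH.eigenvalues i + lam)⁻¹) = fun _ ↦ (1 : ℝ) :=
    funext fun i ↦ mul_inv_cancel₀ (by linarith [hpos i])
  rw [this, Matrix.diagonal_one, map_one]

lemma companionStieltjes_eq_sum (X : Matrix (Fin n) (Fin p) ℝ) (z : ℝ) :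
    companionStieltjes X z = (1 / n) *
      ∑ i, ((Matrix.isHermitian_mul_conjTranspose_self X).eigenvalues i - z)⁻¹ := by
  rw [companionStieltjes, resolventTransform_apply, empiricalDistribution, integral_smul_measure,
    integral_finsetSum_measure fun i _ ↦ integrable_dirac (by simp)]
  simp [resolvent, Ring.inverse_eq_inv']

lemma companionStieltjes_neg (X : Matrix (Fin n) (Fin p) ℝ) (hlam : 0 < lam) :
    companionStieltjes X (-lam) = (1 / n) * (ridgeResolvent X lam).trace := by
  rw [companionStieltjes_eq_sum, ridgeResolvent_eq_conj X hlam, trace_conjStarAlgAut,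
    Matrix.trace_diagonal]
  simp only [sub_neg_eq_add]

lemma deriv_companionStieltjes_neg (X : Matrix (Fin n) (Fin p) ℝ) (hlam : 0 < lam) :
    deriv (companionStieltjes X) (-lam) =
      (1 / n) * (ridgeResolvent X lam * ridgeResolvent X lam).trace := by
  set hH := Matrix.isHermitian_mul_conjTranspose_self X
  have hpos : ∀ i, 0 ≤ hH.eigenvalues i :=
    (Matrix.posSemidef_self_mul_conjTranspose X).eigenvalues_nonneg
  have h : HasDerivAt (companionStieltjes X)
      ((1 / n) * ∑ i, ((hH.eigenvalues i + lam) ^ 2)⁻¹) (-lam) := by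
    rw [funext (companionStieltjes_eq_sum X)]
    refine HasDerivAt.const_mul _ (HasDerivAt.fun_sum fun i _ ↦ ?_)
    have h0 : hH.eigenvalues i - -lam ≠ 0 := by linarith [hpos i]
    have := ((hasDerivAt_id (-lam)).const_sub (hH.eigenvalues i)).fun_inv h0
    simpa using this
  rw [h.deriv, ridgeResolvent_eq_conj X hlam, ← map_mul, trace_conjStarAlgAut,
    Matrix.diagonal_mul_diagonal, Matrix.trace_diagonal]
  simp only [sq, mul_inv]

/-- Adjugate over a determinant that never vanishes. Continuity serves to provide measurability in
the design. -/
lemma continuous_ridgeResolvent (hlam : 0 < lam) :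
    Continuous fun X : Matrix (Fin n) (Fin p) ℝ ↦ ridgeResolvent X lam := by
  have hR : Continuous fun X : Matrix (Fin n) (Fin p) ℝ ↦ ridgeGram X lam := by
    unfold ridgeGram; fun_prop
  unfold ridgeResolvent
  simp only [Matrix.inv_def, Ring.inverse_eq_inv']
  exact (hR.matrix_det.inv₀ fun X ↦ (isUnit_det_ridgeGram X hlam).ne_zero).smul
    hR.matrix_adjugate

lemma continuous_signalMatrix (hlam : 0 < lam) :
    Continuous fun X : Matrix (Fin n) (Fin p) ℝ ↦ signalMatrix X lam := by
  have := continuous_ridgeResolvent (n := n) (p := p) hlam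
  unfold signalMatrix
  fun_prop

lemma ridgeResolvent_mul_orthogonal (X : Matrix (Fin n) (Fin p) ℝ) (lam : ℝ)
    {O : Matrix (Fin p) (Fin p) ℝ} (hO : O ∈ Matrix.orthogonalGroup (Fin p) ℝ) :
    ridgeResolvent (X * O) lam = ridgeResolvent X lam := by
  have h : X * O * (X * O)ᵀ = X * Xᵀ := by
    rw [Matrix.transpose_mul, Matrix.mul_assoc, ← Matrix.mul_assoc O,
      (Matrix.mem_orthogonalGroup_iff _ _).1 hO, Matrix.one_mul]
  rw [ridgeResolvent, ridgeResolvent, ridgeGram, ridgeGram, h]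

lemma signalMatrix_mul_orthogonal (X : Matrix (Fin n) (Fin p) ℝ) (lam : ℝ)
    {O : Matrix (Fin p) (Fin p) ℝ} (hO : O ∈ Matrix.orthogonalGroup (Fin p) ℝ) :
    signalMatrix (X * O) lam = Oᵀ * signalMatrix X lam * O := by
  simp only [signalMatrix, ridgeResolvent_mul_orthogonal X lam hO, Matrix.transpose_mul,
    Matrix.mul_assoc]

end Resolvent

/-- Two vectors of equal norm are related by an orthogonal matrix. -/
lemma exists_orthogonal_mulVec_eq {ι : Type*} [Fintype ι] [DecidableEq ι] {u v : ι → ℝ}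
    (h : u ⬝ᵥ u = v ⬝ᵥ v) : ∃ O ∈ Matrix.orthogonalGroup ι ℝ, O *ᵥ u = v := by
  rcases eq_or_ne u v with rfl | hne
  · exact ⟨1, one_mem _, by simp⟩
  set d := u - v with hd
  have hd0 : d ⬝ᵥ d ≠ 0 := fun h0 ↦ hne (sub_eq_zero.1 (dotProduct_self_eq_zero.1 h0))
  have hdu : d ⬝ᵥ d = 2 * (d ⬝ᵥ u) := by
    simp only [hd, sub_dotProduct, dotProduct_sub, h, dotProduct_comm v u]
    ring
  set P := Matrix.vecMulVec d d with hP
  have hPP : P * P = (d ⬝ᵥ d) • P := by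
    rw [hP, Matrix.vecMulVec_mul_vecMulVec, Matrix.vecMulVec_smul]
  have hPt : Pᵀ = P := by rw [hP, Matrix.transpose_vecMulVec]
  -- The Householder reflection along `d = u - v`; equal norms give `d · d = 2 (d · u)`, so it sends
  -- `u` to `u - d = v`.
  refine ⟨1 - (2 / (d ⬝ᵥ d)) • P, ?_, ?_⟩
  · rw [Matrix.mem_orthogonalGroup_iff, Matrix.transpose_sub, Matrix.transpose_one,
      Matrix.transpose_smul, hPt]
    have : (1 - (2 / (d ⬝ᵥ d)) • P) * (1 - (2 / (d ⬝ᵥ d)) • P)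
        = 1 - (2 / (d ⬝ᵥ d)) • P - (2 / (d ⬝ᵥ d)) • P
          + (2 / (d ⬝ᵥ d)) • (2 / (d ⬝ᵥ d)) • (P * P) := by
      rw [Matrix.sub_mul, Matrix.mul_sub, Matrix.mul_sub, Matrix.one_mul, Matrix.one_mul,
        Matrix.mul_one, Matrix.smul_mul, Matrix.mul_smul]
      abel
    rw [this, hPP, smul_smul, smul_smul, mul_assoc]
    have h2 : 2 / (d ⬝ᵥ d) * (2 / (d ⬝ᵥ d) * (d ⬝ᵥ d)) = 2 / (d ⬝ᵥ d) + 2 / (d ⬝ᵥ d) := by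
      rw [div_mul_cancel₀ _ hd0]; ring
    rw [h2, add_smul]
    abel
  · rw [Matrix.sub_mulVec, Matrix.one_mulVec, Matrix.smul_mulVec, hP, Matrix.vecMulVec_mulVec]
    have h3 : (2 / (d ⬝ᵥ d)) * (d ⬝ᵥ u) = 1 := by
      rw [div_mul_eq_mul_div, ← hdu, div_self hd0]
    ext i
    simp only [Pi.sub_apply, Pi.smul_apply, smul_eq_mul, MulOpposite.smul_eq_mul_unop,
      MulOpposite.unop_op]
    have : (2 / (d ⬝ᵥ d)) * (d i * (d ⬝ᵥ u)) = d i := by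
      rw [mul_left_comm, h3, mul_one]
    rw [this]
    simp [hd]

/-! ### Almost sure convergence from moment bounds -/

section Convergence

variable {Ω : Type*} [MeasurableSpace Ω] {μ : Measure Ω}

lemma MeasureTheory.MemLp.lintegral_abs_rpow_le {q c : ℝ} {f : Ω → ℝ} (hq : 0 < q)
    (hf : MemLp f (ENNReal.ofReal q) μ) (hc : ∫ ω, |f ω| ^ q ∂μ ≤ c) :
    ∫⁻ ω, ENNReal.ofReal (|f ω| ^ q) ∂μ ≤ ENNReal.ofReal c := by
  rw [← ofReal_integral_eq_lintegral_ofReal (hf.integrable_abs_rpow hq)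
    (Eventually.of_forall fun ω ↦ by positivity)]
  exact ENNReal.ofReal_le_ofReal hc

/-- If the `q`-th moment of `T n`, `q > 2`, is of order `n ^ (q / 2)`, then `T n / n → 0` a.s. -/
lemma ae_tendsto_div_of_moment_le {q K : ℝ} (hq : 2 < q) (hK : 0 ≤ K) {T : ℕ → Ω → ℝ}
    (hT : ∀ n, Measurable (T n))
    (h : ∀ᶠ n : ℕ in atTop, ∫⁻ ω, ENNReal.ofReal (|T n ω| ^ q) ∂μ
      ≤ ENNReal.ofReal ((K * n) ^ (q / 2))) :
    ∀ᵐ ω ∂μ, Tendsto (fun n : ℕ ↦ (1 / (n : ℝ)) * T n ω) atTop (𝓝 0) := by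
  have hq0 : 0 < q := by linarith
  -- Shift the sequence past the indices without a bound, and past `n = 0`.
  obtain ⟨N, hN⟩ := eventually_atTop.1 (h.and (eventually_ge_atTop 1))
  have hbound : ∀ n, ∫⁻ ω, ENNReal.ofReal (|(1 / ((n + N : ℕ) : ℝ)) * T (n + N) ω| ^ q) ∂μ
      ≤ ENNReal.ofReal (K ^ (q / 2) * ((n + N : ℕ) : ℝ) ^ (-(q / 2))) := fun n ↦ by
    obtain ⟨h1, h2⟩ := hN (n + N) (by omega)
    generalize n + N = m at h1 h2
    have hm : (0 : ℝ) < m := by exact_mod_cast h2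
    have e1 : ∀ ω, ENNReal.ofReal (|(1 / (m : ℝ)) * T m ω| ^ q)
        = ENNReal.ofReal ((m : ℝ) ^ (-q)) * ENNReal.ofReal (|T m ω| ^ q) := fun ω ↦ by
      rw [← ENNReal.ofReal_mul (by positivity), abs_mul,
        Real.mul_rpow (abs_nonneg _) (abs_nonneg _), abs_of_pos (by positivity : 0 < 1 / (m : ℝ)),
        one_div, Real.inv_rpow hm.le, Real.rpow_neg hm.le]
    simp_rw [e1]
    rw [lintegral_const_mul' _ _ ENNReal.ofReal_ne_top]
    calc _ ≤ ENNReal.ofReal ((m : ℝ) ^ (-q)) * ENNReal.ofReal ((K * m) ^ (q / 2)) := by gcongr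
      _ = _ := by
        rw [← ENNReal.ofReal_mul (by positivity), Real.mul_rpow hK hm.le, mul_left_comm,
          ← Real.rpow_add hm]
        ring_nf
  have hsum : Summable fun n : ℕ ↦ K ^ (q / 2) * ((n + N : ℕ) : ℝ) ^ (-(q / 2)) :=
    ((summable_nat_add_iff N (f := fun n : ℕ ↦ (n : ℝ) ^ (-(q / 2)))).2
      (Real.summable_nat_rpow.2 (by linarith))).mul_left _
  -- By Tonelli the sum of `|T n / n| ^ q` has finite expectation, because `q / 2 > 1`. It is then
  -- finite almost surely, and its terms tend to zero.
  have hlt : ∫⁻ ω, ∑' n, ENNReal.ofReal (|(1 / ((n + N : ℕ) : ℝ)) * T (n + N) ω| ^ q) ∂μ ≠ ⊤ := by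
    rw [lintegral_tsum fun n ↦ by have := hT (n + N); fun_prop]
    exact ne_top_of_le_ne_top hsum.tsum_ofReal_ne_top (ENNReal.tsum_le_tsum hbound)
  filter_upwards [ae_lt_top' (by have := fun n ↦ hT (n + N); fun_prop) hlt] with ω hω
  have h0 := ENNReal.tendsto_atTop_zero_of_tsum_ne_top hω.ne
  have h1 := (ENNReal.tendsto_toReal ENNReal.zero_ne_top).comp h0
  have h2 := h1.rpow_const (p := 1 / q) (Or.inr (by positivity))
  rw [← tendsto_add_atTop_iff_nat N, tendsto_zero_iff_norm_tendsto_zero]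
  rw [ENNReal.toReal_zero, Real.zero_rpow (by positivity)] at h2
  refine h2.congr fun n ↦ ?_
  simp only [Function.comp]
  rw [ENNReal.toReal_ofReal (by positivity), ← Real.rpow_mul (abs_nonneg _),
    mul_one_div_cancel hq0.ne', Real.rpow_one, Real.norm_eq_abs]

/-- A conditional bound given one of two independent variables integrates. -/
lemma ProbabilityTheory.IndepFun.lintegral_le_of_ae_le [IsProbabilityMeasure μ] {α β : Type*}
    [MeasurableSpace α] [MeasurableSpace β] {W : Ω → α} {e : Ω → β} (h : IndepFun W e μ)
    (hW : Measurable W) (he : Measurable e) {F : α → β → ℝ≥0∞}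
    (hF : Measurable fun z : α × β ↦ F z.1 z.2) {c : ℝ≥0∞}
    (hc : ∀ᵐ ω ∂μ, ∫⁻ ω', F (W ω) (e ω') ∂μ ≤ c) :
    ∫⁻ ω, F (W ω) (e ω) ∂μ ≤ c := by
  have hprod := (indepFun_iff_map_prod_eq_prod_map_map hW.aemeasurable he.aemeasurable).1 h
  have : IsProbabilityMeasure (μ.map e) := Measure.isProbabilityMeasure_map he.aemeasurable
  have hin : ∀ a, ∫⁻ b, F a b ∂(μ.map e) = ∫⁻ ω', F a (e ω') ∂μ := fun a ↦
    lintegral_map (hF.comp measurable_prodMk_left) he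
  calc ∫⁻ ω, F (W ω) (e ω) ∂μ
      = ∫⁻ z, F z.1 z.2 ∂(μ.map fun ω ↦ (W ω, e ω)) := (lintegral_map hF (hW.prodMk he)).symm
    _ = ∫⁻ a, ∫⁻ b, F a b ∂(μ.map e) ∂(μ.map W) := by
        rw [hprod, lintegral_prod _ hF.aemeasurable]
    _ = ∫⁻ ω, ∫⁻ b, F (W ω) b ∂(μ.map e) ∂μ :=
        lintegral_map hF.lintegral_prod_right' hW
    _ ≤ ∫⁻ _, c ∂μ := lintegral_mono_ae (by simpa only [hin] using hc)
    _ = c := by simp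

/-- The moments of a variable and of its centred square, from a single moment of high order. -/
lemma moments_of_lintegral_le [IsProbabilityMeasure μ] {q : ℝ} (hq : 2 < q) {f : Ω → ℝ}
    (hf : Measurable f) {M : ℝ≥0}
    (hM : ∫⁻ ω, ENNReal.ofReal (|f ω| ^ (2 * q)) ∂μ ≤ M) (v : ℝ) :
    MemLp f (ENNReal.ofReal q) μ ∧ MemLp (fun ω ↦ f ω ^ 2 - v) (ENNReal.ofReal q) μ ∧
    ∫ ω, |f ω| ^ q ∂μ ≤ 1 + M ∧ ∫ ω, |f ω ^ 2 - v| ^ q ∂μ ≤ 2 ^ q * (M + |v| ^ q) := by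
  have hq0 : 0 < q := by linarith
  have i2 : Integrable (fun ω ↦ |f ω| ^ (2 * q)) μ := by
    refine ⟨(hf.abs.pow_const _).aestronglyMeasurable, ?_⟩
    rw [hasFiniteIntegral_iff_ofReal (Eventually.of_forall fun ω ↦ by positivity)]
    exact hM.trans_lt ENNReal.coe_lt_top
  have b2 : ∫ ω, |f ω| ^ (2 * q) ∂μ ≤ M := by
    rw [integral_eq_lintegral_of_nonneg_ae (Eventually.of_forall fun ω ↦ by positivity)
      i2.aestronglyMeasurable]
    exact ENNReal.toReal_le_coe_of_le_coe hM
  have p1 : ∀ ω, |f ω| ^ q ≤ 1 + |f ω| ^ (2 * q) := fun ω ↦ by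
    rw [two_mul, Real.rpow_add_of_nonneg (abs_nonneg _) hq0.le hq0.le]
    nlinarith [sq_nonneg (|f ω| ^ q - 1), Real.rpow_nonneg (abs_nonneg (f ω)) q]
  have p2 : ∀ ω, |f ω ^ 2 - v| ^ q ≤ 2 ^ q * (|f ω| ^ (2 * q) + |v| ^ q) := fun ω ↦ by
    have h := abs_add_rpow_le hq0.le (f ω ^ 2) (-v)
    rw [← sub_eq_add_neg, abs_neg, abs_of_nonneg (sq_nonneg (f ω))] at h
    rwa [abs_rpow_eq_sq_rpow (2 * q), mul_div_cancel_left₀ q two_ne_zero]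
  have j1 : Integrable (fun ω ↦ 1 + |f ω| ^ (2 * q)) μ := (integrable_const 1).add i2
  have j2 : Integrable (fun ω ↦ 2 ^ q * (|f ω| ^ (2 * q) + |v| ^ q)) μ :=
    (i2.add (integrable_const _)).const_mul _
  have k1 : Integrable (fun ω ↦ |f ω| ^ q) μ :=
    j1.mono' (hf.abs.pow_const _).aestronglyMeasurable (Eventually.of_forall fun ω ↦ by
      rw [Real.norm_of_nonneg (by positivity)]; exact p1 ω)
  have k2 : Integrable (fun ω ↦ |f ω ^ 2 - v| ^ q) μ :=
    j2.mono' (((hf.pow_const 2).sub_const v).abs.pow_const _).aestronglyMeasurable (Eventually.of_forall fun ω ↦ by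
      rw [Real.norm_of_nonneg (by positivity)]; exact p2 ω)
  refine ⟨MemLp.of_integrable_abs_rpow hq0 (by fun_prop) k1,
    MemLp.of_integrable_abs_rpow hq0 (by fun_prop) k2, ?_, ?_⟩
  · refine (integral_mono k1 j1 p1).trans ?_
    rw [integral_add (integrable_const _) i2]
    simpa using b2
  · refine (integral_mono k2 j2 p2).trans ?_
    rw [integral_const_mul, integral_add i2 (integrable_const _)]
    simp only [integral_const, probReal_univ, smul_eq_mul, one_mul]
    gcongr

end Convergence

lemma centredForm_univ {ι : Type*} [Fintype ι] (B : Matrix ι ι ℝ) (v : ℝ) (x : ι → ℝ) :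
    centredForm B v Finset.univ x = x ⬝ᵥ (B *ᵥ x) - v * B.trace := by
  simp only [centredForm, dotProduct, Matrix.mulVec, Matrix.trace, Matrix.diag, Finset.mul_sum]
  congr 1
  exact Finset.sum_congr rfl fun i _ ↦ Finset.sum_congr rfl fun j _ ↦ by ring

/-! ### Symmetric random signs -/

section Signs

/-- The fair coin. -/
noncomputable def fairCoin : Measure Bool :=
  (2 : ℝ≥0∞)⁻¹ • (Measure.dirac true + Measure.dirac false)

instance : IsProbabilityMeasure fairCoin := by
  constructor
  simp only [fairCoin, Measure.smul_apply, Measure.add_apply, measure_univ, smul_eq_mul]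
  rw [one_add_one_eq_two, ENNReal.inv_mul_cancel (by simp) (by simp)]

/-- The sign of a coin flip. -/
noncomputable def coinSign (b : Bool) : ℝ := if b then 1 else -1

lemma coinSign_mul_self (b : Bool) : coinSign b * coinSign b = 1 := by
  cases b <;> simp [coinSign]

lemma abs_coinSign (b : Bool) : |coinSign b| = 1 := by
  cases b <;> simp [coinSign]

lemma measurable_coinSign : Measurable coinSign := measurable_of_countable _

lemma integral_coinSign : ∫ b, coinSign b ∂fairCoin = 0 := by
  rw [fairCoin, integral_smul_measure, integral_add_measure (integrable_dirac (by simp))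
    (integrable_dirac (by simp)), integral_dirac, integral_dirac]
  simp [coinSign]

/-- Signs have square exactly 1, so the diagonal fluctuation vanishes and `N = 0` is allowed. -/
lemma lintegral_abs_centredForm_coinSign_le {p : ℕ} {q κ : ℝ} (hq : 2 < q) (hκ : 0 ≤ κ)
    {B : Matrix (Fin p) (Fin p) ℝ} (hsymm : B.IsSymm) (hB : ∀ i, ∑ j, B i j ^ 2 ≤ κ) :
    ∫⁻ s, ENNReal.ofReal (|centredForm B 1 Finset.univ fun i ↦ coinSign (s i)| ^ q)
      ∂(Measure.pi fun _ : Fin p ↦ fairCoin) ≤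
        ENNReal.ofReal ((formConst q κ 1 0 * (1 + p)) ^ (q / 2)) := by
  have hind : iIndepFun (fun (i : Fin p) (s : Fin p → Bool) ↦ coinSign (s i))
      (Measure.pi fun _ : Fin p ↦ fairCoin) :=
    iIndepFun_pi fun _ ↦ measurable_coinSign.aemeasurable
  have hm : ∀ i : Fin p, Measurable fun s : Fin p → Bool ↦ coinSign (s i) := fun i ↦
    measurable_coinSign.comp (measurable_pi_apply i)
  have hsq : ∀ (i : Fin p) (s : Fin p → Bool), coinSign (s i) ^ 2 - 1 = 0 := fun i s ↦ by
    rw [sq, coinSign_mul_self, sub_self]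
  have h := integral_abs_centredForm_le (v := 1) (κ := κ) (M := 1) (N := 0) hq hind hm
    (fun i ↦ MemLp.of_bound (hm i).aestronglyMeasurable 1
      (Eventually.of_forall fun s ↦ (abs_coinSign _).le))
    (fun i ↦ by simp [hsq])
    (fun i ↦ by
      rw [← integral_coinSign]
      exact integral_comp_eval (μ := fun _ : Fin p ↦ fairCoin) (i := i)
        measurable_coinSign.aestronglyMeasurable)
    (fun i ↦ by simp [hsq]) one_pos (fun i ↦ by simp [abs_coinSign]) le_rfl
    (fun i ↦ by simp [hsq, Real.zero_rpow (by linarith : q ≠ 0)]) hsymm hκ hB Finset.univ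
  rw [Finset.card_univ, Fintype.card_fin] at h
  exact h.1.lintegral_abs_rpow_le (by linarith) h.2

end Signs

/-! ### Quadratic forms of rotationally invariant matrices -/

section Rotation

variable {Ω : Type*} [MeasurableSpace Ω] {μ : Measure Ω} {n p : ℕ} {lam : ℝ}

/-- The deviation of the quadratic form in the signal from its average over rotations. -/
noncomputable def signalDeviation (lam : ℝ) (X : Matrix (Fin n) (Fin p) ℝ) (b : Fin p → ℝ) : ℝ :=
  b ⬝ᵥ (signalMatrix X lam *ᵥ b) - (b ⬝ᵥ b) / p * (signalMatrix X lam).trace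

/-- Rotating the design conjugates the signal matrix, which can be undone by rotating the vector;
the trace and the norm do not change. -/
lemma signalDeviation_mul_orthogonal (X : Matrix (Fin n) (Fin p) ℝ)
    {O : Matrix (Fin p) (Fin p) ℝ} (hO : O ∈ Matrix.orthogonalGroup (Fin p) ℝ) {u b : Fin p → ℝ}
    (hu : u ⬝ᵥ u = b ⬝ᵥ b) (hOu : O *ᵥ u = b) :
    signalDeviation lam (X * O) u = signalDeviation lam X b := by
  have h1 : (signalMatrix (X * O) lam).trace = (signalMatrix X lam).trace := by
    rw [signalMatrix_mul_orthogonal X lam hO, Matrix.trace_mul_comm, ← Matrix.mul_assoc,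
      (Matrix.mem_orthogonalGroup_iff _ _).1 hO, Matrix.one_mul]
  have h2 : u ⬝ᵥ (signalMatrix (X * O) lam *ᵥ u) = b ⬝ᵥ (signalMatrix X lam *ᵥ b) := by
    rw [signalMatrix_mul_orthogonal X lam hO, ← Matrix.mulVec_mulVec u (Oᵀ * _) O, hOu,
      ← Matrix.mulVec_mulVec b Oᵀ, Matrix.dotProduct_mulVec u, Matrix.vecMul_transpose, hOu]
  rw [signalDeviation, signalDeviation, h1, h2, hu]

lemma measurable_signalDeviation (hlam : 0 < lam) :
    Measurable fun z : Matrix (Fin n) (Fin p) ℝ × (Fin p → ℝ) ↦ signalDeviation lam z.1 z.2 := by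
  have h : ∀ i j, Measurable fun z : Matrix (Fin n) (Fin p) ℝ × (Fin p → ℝ) ↦
      signalMatrix z.1 lam i j := fun i j ↦
    (((continuous_signalMatrix hlam).matrix_elem i j).measurable).comp measurable_fst
  unfold signalDeviation
  simp only [dotProduct, Matrix.mulVec, Matrix.trace, Matrix.diag]
  fun_prop

/-- Choose the rotation taking `u` to `b` and use that `X O` and `X` have the same law. -/
lemma lintegral_signalDeviation_eq (hlam : 0 < lam) {X : Ω → Matrix (Fin n) (Fin p) ℝ}
    (hrot : IsRightRotationallyInvariant μ X) (q : ℝ) {u b : Fin p → ℝ}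
    (hu : u ⬝ᵥ u = b ⬝ᵥ b) :
    ∫⁻ ω, ENNReal.ofReal (|signalDeviation lam (X ω) b| ^ q) ∂μ =
      ∫⁻ ω, ENNReal.ofReal (|signalDeviation lam (X ω) u| ^ q) ∂μ := by
  obtain ⟨O, hO, hOu⟩ := exists_orthogonal_mulVec_eq hu
  have hm : Measurable fun x : Matrix (Fin n) (Fin p) ℝ ↦
      ENNReal.ofReal (|signalDeviation lam x u| ^ q) := by
    have := (measurable_signalDeviation (n := n) (p := p) hlam).comp
      (measurable_id.prodMk (measurable_const (a := u)))
    simp only [Function.comp_def, id] at this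
    fun_prop
  have h := ((hrot O hO).comp hm).lintegral_eq
  simp only [Function.comp_def] at h
  rw [← h]
  simp only [signalDeviation_mul_orthogonal _ hO hu hOu]

/-- The moments of the quadratic form in a fixed signal. -/
lemma lintegral_signalDeviation_le [IsProbabilityMeasure μ] (hlam : 0 < lam)
    {X : Ω → Matrix (Fin n) (Fin p) ℝ}
    (hX : Measurable X) (hrot : IsRightRotationallyInvariant μ X) {q : ℝ} (hq : 2 < q)
    (hp : 0 < p) (b : Fin p → ℝ) :
    ∫⁻ ω, ENNReal.ofReal (|signalDeviation lam (X ω) b| ^ q) ∂μ ≤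
      ENNReal.ofReal (((b ⬝ᵥ b) / p) ^ q *
        (formConst q (lam ^ 2)⁻¹ 1 0 * (1 + p)) ^ (q / 2)) := by
  have hp' : (0 : ℝ) < p := by exact_mod_cast hp
  have hb := dotProduct_self_nonneg_real b
  set t := (b ⬝ᵥ b) / p with ht
  have ht0 : 0 ≤ t := by positivity
  set ν := Measure.pi fun _ : Fin p ↦ fairCoin with hν
  -- For every outcome of the coins this has the norm of `b`, so the integral over the design may be
  -- averaged over the signs. After exchanging the integrals, `X` is frozen and only the signs are
  -- random.
  set u : (Fin p → Bool) → Fin p → ℝ := fun s i ↦ √t * coinSign (s i) with hu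
  have hss : ∀ s : Fin p → Bool,
      (fun i ↦ coinSign (s i)) ⬝ᵥ (fun i ↦ coinSign (s i)) = (p : ℝ) := fun s ↦ by
    simp [dotProduct, coinSign_mul_self]
  have husmul : ∀ s, u s = √t • fun i ↦ coinSign (s i) := fun s ↦ rfl
  have huu : ∀ s, u s ⬝ᵥ u s = b ⬝ᵥ b := fun s ↦ by
    rw [husmul, smul_dotProduct, dotProduct_smul, hss, smul_eq_mul, smul_eq_mul, ← mul_assoc,
      Real.mul_self_sqrt ht0, ht, div_mul_cancel₀ _ hp'.ne']
  have hdev : ∀ (x : Matrix (Fin n) (Fin p) ℝ) (s : Fin p → Bool), signalDeviation lam x (u s) =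
      t * centredForm (signalMatrix x lam) 1 Finset.univ fun i ↦ coinSign (s i) := fun x s ↦ by
    rw [signalDeviation, huu, ← ht, husmul, Matrix.mulVec_smul, smul_dotProduct, dotProduct_smul,
      centredForm_univ, smul_eq_mul, smul_eq_mul, ← mul_assoc, Real.mul_self_sqrt ht0]
    ring
  have hum : Measurable u := measurable_of_countable _
  have hm : Measurable fun z : (Fin p → Bool) × Ω ↦
      ENNReal.ofReal (|signalDeviation lam (X z.2) (u z.1)| ^ q) := by
    have := (measurable_signalDeviation (n := n) (p := p) hlam).comp
      ((hX.comp measurable_snd).prodMk (hum.comp (measurable_fst (α := Fin p → Bool) (β := Ω))))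
    simp only [Function.comp_def] at this
    fun_prop
  calc ∫⁻ ω, ENNReal.ofReal (|signalDeviation lam (X ω) b| ^ q) ∂μ
      = ∫⁻ _, ∫⁻ ω, ENNReal.ofReal (|signalDeviation lam (X ω) b| ^ q) ∂μ ∂ν := by simp
    _ = ∫⁻ s, ∫⁻ ω, ENNReal.ofReal (|signalDeviation lam (X ω) (u s)| ^ q) ∂μ ∂ν :=
        lintegral_congr fun s ↦ lintegral_signalDeviation_eq hlam hrot q (huu s)
    _ = ∫⁻ ω, ∫⁻ s, ENNReal.ofReal (|signalDeviation lam (X ω) (u s)| ^ q) ∂ν ∂μ :=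
        lintegral_lintegral_swap hm.aemeasurable
    _ ≤ ∫⁻ _, ENNReal.ofReal (t ^ q *
          (formConst q (lam ^ 2)⁻¹ 1 0 * (1 + p)) ^ (q / 2)) ∂μ := by
        refine lintegral_mono fun ω ↦ ?_
        simp only [hdev, abs_mul, abs_of_nonneg ht0]
        simp_rw [Real.mul_rpow ht0 (abs_nonneg _), ENNReal.ofReal_mul (Real.rpow_nonneg ht0 q)]
        rw [lintegral_const_mul' _ _ ENNReal.ofReal_ne_top]
        gcongr
        exact lintegral_abs_centredForm_coinSign_le hq (by positivity)
          (signalMatrix_isSymm _ _) (sum_row_signalMatrix_sq_le _ hlam)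
    _ = _ := by simp

end Rotation

/-! ### The three random terms of the training error -/

section Terms

variable {Ω : Type*} [MeasurableSpace Ω] {μ : Measure Ω} [IsProbabilityMeasure μ]
  {p : ℕ → ℕ} {γ r σ lam q : ℝ} {M : ℝ≥0}
  {X : (n : ℕ) → Ω → Matrix (Fin n) (Fin (p n)) ℝ} {β : (n : ℕ) → Ω → (Fin (p n) → ℝ)}
  {ε : (n : ℕ) → Ω → (Fin n → ℝ)}

lemma measurable_ridgeResolvent_sq_apply {n p : ℕ} (hlam : 0 < lam) (i j : Fin n) :
    Measurable fun x : Matrix (Fin n) (Fin p) ℝ ↦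
      (ridgeResolvent x lam * ridgeResolvent x lam) i j := by
  have h := continuous_ridgeResolvent (n := n) (p := p) hlam
  exact ((h.matrix_mul h).matrix_elem i j).measurable

section FixedNoise

variable {n : ℕ} {e : Ω → Fin n → ℝ}

/-- The moments of a quadratic form with deterministic coefficients in the noise. -/
lemma lintegral_noise_quadratic_le {κ : ℝ} (hq : 2 < q) (hκ : 0 ≤ κ) (hn : 1 ≤ n)
    (he : Measurable e) (hindep : iIndepFun (fun i ω ↦ e ω i) μ)
    (hmean : ∀ i, ∫ ω, e ω i ∂μ = 0) (hvar : ∀ i, ∫ ω, (e ω i) ^ 2 ∂μ = σ ^ 2)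
    (hmom : ∀ i, ∫⁻ ω, ENNReal.ofReal (|e ω i| ^ (2 * q)) ∂μ ≤ M)
    {B : Matrix (Fin n) (Fin n) ℝ} (hB : B.IsSymm) (hBκ : ∀ i, ∑ j, B i j ^ 2 ≤ κ) :
    ∫⁻ ω, ENNReal.ofReal (|centredForm B (σ ^ 2) Finset.univ (e ω)| ^ q) ∂μ ≤
      ENNReal.ofReal ((2 * formConst q κ ((1 + M) ^ (2 / q)) (2 ^ q * (M + |σ ^ 2| ^ q)) * n)
        ^ (q / 2)) := by
  have hq0 : 0 < q := by linarith
  have hei : ∀ i, Measurable fun ω ↦ e ω i := fun i ↦ (measurable_pi_apply i).comp he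
  have hmoments := fun i ↦ moments_of_lintegral_le hq (hei i) (hmom i) (σ ^ 2)
  have hN : 0 ≤ 2 ^ q * ((M : ℝ) + |σ ^ 2| ^ q) := by positivity
  have hM : (0 : ℝ) < (1 + M) ^ (2 / q) := by positivity
  have hK := formConst_pos hq hκ hM hN
  have hn' : (1 : ℝ) ≤ n := by exact_mod_cast hn
  have hcentred : ∀ i, ∫ ω, (e ω i ^ 2 - σ ^ 2) ∂μ = 0 := fun i ↦ by
    have h1 : Integrable (fun ω ↦ e ω i ^ 2 - σ ^ 2) μ :=
      (hmoments i).2.1.integrable (by simpa using (by linarith : (1 : ℝ) ≤ q))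
    have h2 : Integrable (fun ω ↦ e ω i ^ 2) μ := by
      refine (h1.add (integrable_const (σ ^ 2))).congr (Eventually.of_forall fun ω ↦ ?_)
      simp
    rw [integral_sub h2 (integrable_const _), hvar]
    simp
  have h := integral_abs_centredForm_le (v := σ ^ 2) hq hindep hei
    (fun i ↦ (hmoments i).1) (fun i ↦ (hmoments i).2.1) hmean hcentred hM
    (fun i ↦ (hmoments i).2.2.1.trans_eq (rpow_two_div_rpow hq0 (by positivity)).symm)
    hN (fun i ↦ (hmoments i).2.2.2) hB hκ hBκ Finset.univ
  refine h.1.lintegral_abs_rpow_le hq0 (h.2.trans ?_)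
  rw [Finset.card_univ, Fintype.card_fin]
  refine Real.rpow_le_rpow (by positivity) ?_ (by positivity)
  nlinarith

/-- The moments of a linear form with deterministic coefficients in the noise. -/
lemma lintegral_noise_linear_le {c : ℝ} (hq : 2 < q) (hn : 1 ≤ n)
    (he : Measurable e) (hindep : iIndepFun (fun i ω ↦ e ω i) μ)
    (hmean : ∀ i, ∫ ω, e ω i ∂μ = 0)
    (hmom : ∀ i, ∫⁻ ω, ENNReal.ofReal (|e ω i| ^ (2 * q)) ∂μ ≤ M)
    {a : Fin n → ℝ} (ha : a ⬝ᵥ a ≤ c * n) :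
    ∫⁻ ω, ENNReal.ofReal (|a ⬝ᵥ e ω| ^ q) ∂μ ≤
      ENNReal.ofReal ((momentConst q * ((1 + M) ^ (2 / q) * (c + 2)) * n) ^ (q / 2)) := by
  have hq0 : 0 < q := by linarith
  have hei : ∀ i, Measurable fun ω ↦ e ω i := fun i ↦ (measurable_pi_apply i).comp he
  have hmoments := fun i ↦ moments_of_lintegral_le hq (hei i) (hmom i) 0
  have hM : (0 : ℝ) < (1 + M) ^ (2 / q) := by positivity
  have hK := one_le_momentConst hq
  have hn' : (1 : ℝ) ≤ n := by exact_mod_cast hn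
  -- The added 1 makes the majorants positive. With the leading 1 of the linear form bound, the
  -- total is at most `(c + 2) * n`.
  have hsum : ∑ i, (a i ^ 2 + 1) ≤ (c + 1) * n := by
    rw [dotProduct] at ha
    simp only [Finset.sum_add_distrib, sq (a _), Finset.sum_const, Finset.card_univ,
      Fintype.card_fin, nsmul_eq_mul, mul_one]
    linarith
  have h := integral_abs_linear_form_le hq hindep hei (fun i ↦ (hmoments i).1) hmean hM
    (fun i ↦ (hmoments i).2.2.1.trans_eq (rpow_two_div_rpow hq0 (by positivity)).symm)
    a (fun i ↦ a i ^ 2 + 1) (fun i ↦ by positivity) (fun i ↦ by linarith) Finset.univ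
  refine (memLp_linear_form (fun i ↦ (hmoments i).1) a Finset.univ).lintegral_abs_rpow_le hq0
    (h.trans ?_)
  have h0 : 0 ≤ ∑ i, (a i ^ 2 + 1) := Finset.sum_nonneg fun i _ ↦ by positivity
  rw [mul_assoc, mul_assoc]
  refine Real.rpow_le_rpow (by positivity) ?_ (by positivity)
  gcongr
  linarith

end FixedNoise

lemma measurable_dotProduct_comp {α ι : Type*} [MeasurableSpace α] [Fintype ι] {x y : α → ι → ℝ}
    (hx : ∀ i, Measurable fun a ↦ x a i) (hy : ∀ i, Measurable fun a ↦ y a i) :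
    Measurable fun a ↦ x a ⬝ᵥ y a :=
  Finset.measurable_fun_sum _ fun i _ ↦ (hx i).mul (hy i)

lemma measurable_mulVec_comp {α ι κ : Type*} [MeasurableSpace α] [Fintype κ]
    {B : α → Matrix ι κ ℝ} {x : α → κ → ℝ} (hB : ∀ i j, Measurable fun a ↦ B a i j)
    (hx : ∀ i, Measurable fun a ↦ x a i) (i : ι) : Measurable fun a ↦ (B a *ᵥ x a) i :=
  measurable_dotProduct_comp (hB i) hx

lemma measurable_centredForm_comp {α ι : Type*} [MeasurableSpace α] {B : α → Matrix ι ι ℝ}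
    {x : α → ι → ℝ} (hB : ∀ i j, Measurable fun a ↦ B a i j)
    (hx : ∀ i, Measurable fun a ↦ x a i) (v : ℝ) (s : Finset ι) :
    Measurable fun a ↦ centredForm (B a) v s (x a) :=
  (Finset.measurable_fun_sum s fun i _ ↦ Finset.measurable_fun_sum s fun j _ ↦
    ((hB i j).mul (hx i)).mul (hx j)).sub
      ((Finset.measurable_fun_sum s fun i _ ↦ hB i i).const_mul v)

lemma measurable_noise_quadratic {n p : ℕ} (hlam : 0 < lam) (v : ℝ) :
    Measurable fun z : Matrix (Fin n) (Fin p) ℝ × (Fin n → ℝ) ↦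
      centredForm (ridgeResolvent z.1 lam * ridgeResolvent z.1 lam) v Finset.univ z.2 :=
  measurable_centredForm_comp
    (fun i j ↦ (measurable_ridgeResolvent_sq_apply hlam i j).comp measurable_fst)
    (fun i ↦ (measurable_pi_apply i).comp measurable_snd) v Finset.univ

lemma measurable_noise_linear {n p : ℕ} (hlam : 0 < lam) :
    Measurable fun z : (Matrix (Fin n) (Fin p) ℝ × (Fin p → ℝ)) × (Fin n → ℝ) ↦
      (ridgeResolvent z.1.1 lam * ridgeResolvent z.1.1 lam) *ᵥ (z.1.1 *ᵥ z.1.2) ⬝ᵥ z.2 :=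
  measurable_dotProduct_comp
    (measurable_mulVec_comp
      (fun i j ↦ (measurable_ridgeResolvent_sq_apply hlam i j).comp
        (measurable_fst.comp measurable_fst))
      (measurable_mulVec_comp
        (fun i j ↦ ((continuous_id.matrix_elem i j).measurable).comp
          (measurable_fst.comp measurable_fst))
        (fun i ↦ (measurable_pi_apply i).comp (measurable_snd.comp measurable_fst))))
    (fun i ↦ (measurable_pi_apply i).comp measurable_snd)

/-- Freeze the design, which is independent of the noise; the rows of `R²` have squared norm at most
`λ⁻⁴` whatever its value. -/
lemma ae_tendsto_noise_quadratic (hq : 2 < q) (hlam : 0 < lam)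
    (hX : ∀ n, Measurable (X n)) (hε : ∀ n, Measurable (ε n))
    (hXε : ∀ n, 1 ≤ n → IndepFun (X n) (ε n) μ)
    (hindep : ∀ n, 1 ≤ n → iIndepFun (fun i ω => ε n ω i) μ)
    (hmean : ∀ n i, ∫ ω, ε n ω i ∂μ = 0)
    (hvar : ∀ n i, ∫ ω, (ε n ω i) ^ 2 ∂μ = σ ^ 2)
    (hmom : ∀ n i, ∫⁻ ω, ENNReal.ofReal (|ε n ω i| ^ (2 * q)) ∂μ ≤ M) :
    ∀ᵐ ω ∂μ, Tendsto (fun n : ℕ ↦ (1 / (n : ℝ)) *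
      centredForm (ridgeResolvent (X n ω) lam * ridgeResolvent (X n ω) lam) (σ ^ 2)
        Finset.univ (ε n ω)) atTop (𝓝 0) := by
  have hK := formConst_pos hq (κ := (lam ^ 4)⁻¹) (M := (1 + M) ^ (2 / q))
    (N := 2 ^ q * (M + |σ ^ 2| ^ q)) (by positivity) (by positivity) (by positivity)
  have hF : ∀ n, Measurable fun z : Matrix (Fin n) (Fin (p n)) ℝ × (Fin n → ℝ) ↦
      centredForm (ridgeResolvent z.1 lam * ridgeResolvent z.1 lam) (σ ^ 2) Finset.univ z.2 :=
    fun n ↦ measurable_noise_quadratic hlam (σ ^ 2)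
  have hT := fun n ↦ (hF n).comp ((hX n).prodMk (hε n))
  refine ae_tendsto_div_of_moment_le (mul_nonneg zero_le_two hK.le) (hq := hq) hT ?_
  filter_upwards [eventually_ge_atTop 1] with n hn
  refine (hXε n hn).lintegral_le_of_ae_le (hX n) (hε n) (F := fun x y ↦ ENNReal.ofReal
    (|centredForm (ridgeResolvent x lam * ridgeResolvent x lam) (σ ^ 2) Finset.univ y| ^ q))
    (((hF n).abs.pow_const q).ennreal_ofReal)
    (Eventually.of_forall fun ω ↦ ?_)
  exact lintegral_noise_quadratic_le hq (by positivity) hn (hε n) (hindep n hn) (hmean n)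
    (hvar n) (hmom n) (ridgeResolvent_sq_isSymm (X n ω) lam)
    (sum_row_ridgeResolvent_sq_le (X n ω) hlam)

/-- Freeze both design and signal: `|R² X β|² ≤ λ⁻³ r² n` almost surely, so the cross term has
fluctuations of order `√n`. -/
lemma ae_tendsto_noise_linear (hq : 2 < q) (hlam : 0 < lam)
    (hX : ∀ n, Measurable (X n)) (hβ : ∀ n, Measurable (β n)) (hε : ∀ n, Measurable (ε n))
    (hXβε : ∀ n, 1 ≤ n → IndepFun (fun ω => (X n ω, β n ω)) (ε n) μ)
    (hr : ∀ n, 1 ≤ n → ∀ᵐ ω ∂μ, β n ω ⬝ᵥ β n ω = r ^ 2 * n)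
    (hindep : ∀ n, 1 ≤ n → iIndepFun (fun i ω => ε n ω i) μ)
    (hmean : ∀ n i, ∫ ω, ε n ω i ∂μ = 0)
    (hmom : ∀ n i, ∫⁻ ω, ENNReal.ofReal (|ε n ω i| ^ (2 * q)) ∂μ ≤ M) :
    ∀ᵐ ω ∂μ, Tendsto (fun n : ℕ ↦ (1 / (n : ℝ)) *
      ((ridgeResolvent (X n ω) lam * ridgeResolvent (X n ω) lam) *ᵥ (X n ω *ᵥ β n ω) ⬝ᵥ ε n ω))
        atTop (𝓝 0) := by
  have hK := one_le_momentConst hq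
  have hF : ∀ n, Measurable fun z : (Matrix (Fin n) (Fin (p n)) ℝ × (Fin (p n) → ℝ)) ×
      (Fin n → ℝ) ↦
        (ridgeResolvent z.1.1 lam * ridgeResolvent z.1.1 lam) *ᵥ (z.1.1 *ᵥ z.1.2) ⬝ᵥ z.2 :=
    fun n ↦ measurable_noise_linear hlam
  have hT := fun n ↦ (hF n).comp (((hX n).prodMk (hβ n)).prodMk (hε n))
  refine ae_tendsto_div_of_moment_le
    (K := momentConst q * ((1 + M) ^ (2 / q) * ((lam ^ 3)⁻¹ * r ^ 2 + 2))) hq (by positivity)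
    hT ?_
  filter_upwards [eventually_ge_atTop 1] with n hn
  refine (hXβε n hn).lintegral_le_of_ae_le ((hX n).prodMk (hβ n)) (hε n)
    (F := fun x y ↦ ENNReal.ofReal
      (|(ridgeResolvent x.1 lam * ridgeResolvent x.1 lam) *ᵥ (x.1 *ᵥ x.2) ⬝ᵥ y| ^ q))
    (((hF n).abs.pow_const q).ennreal_ofReal) ?_
  filter_upwards [hr n hn] with ω hω
  refine lintegral_noise_linear_le hq hn (hε n) (hindep n hn) (hmean n) (hmom n) ?_
  have h := ridgeResolvent_sq_design_mulVec_sq_le (X n ω) hlam (β n ω)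
  rwa [hω, ← mul_assoc] at h

/-- Here the signal is frozen and the design stays random, since its rotational invariance drives
the concentration. -/
lemma ae_tendsto_signalDeviation (hq : 2 < q) (hlam : 0 < lam) (hγ : 0 < γ)
    (hp : Tendsto (fun n : ℕ => (p n : ℝ) / (n : ℝ)) atTop (𝓝 γ))
    (hX : ∀ n, Measurable (X n)) (hβ : ∀ n, Measurable (β n))
    (hrot : ∀ n, 1 ≤ n → IsRightRotationallyInvariant μ (X n))
    (hXβ : ∀ n, 1 ≤ n → IndepFun (X n) (β n) μ)
    (hr : ∀ n, 1 ≤ n → ∀ᵐ ω ∂μ, β n ω ⬝ᵥ β n ω = r ^ 2 * n) :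
    ∀ᵐ ω ∂μ, Tendsto (fun n : ℕ ↦ (1 / (n : ℝ)) * signalDeviation lam (X n ω) (β n ω))
        atTop (𝓝 0) := by
  have hK := formConst_pos hq (κ := (lam ^ 2)⁻¹) (M := 1) (N := 0) (by positivity) one_pos le_rfl
  refine ae_tendsto_div_of_moment_le
    -- Eventually `γ / 2 < p / n < 2 γ`, whence `r² n / p ≤ 2 r² / γ` and `1 + p ≤ (1 + 2 γ) n`. The
    -- first factor is squared because `K` is raised to `q / 2`.
    (K := (2 * r ^ 2 / γ) ^ 2 * (formConst q (lam ^ 2)⁻¹ 1 0 * (1 + 2 * γ))) hq (by positivity)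
    (fun n ↦ (measurable_signalDeviation hlam).comp ((hX n).prodMk (hβ n))) ?_
  filter_upwards [eventually_ge_atTop 1, hp.eventually_lt_const (by linarith : γ < 2 * γ),
    hp.eventually_const_lt (by linarith : γ / 2 < γ)] with n hn h1 h2
  have hn' : (1 : ℝ) ≤ n := by exact_mod_cast hn
  have hn0 : (0 : ℝ) < n := by linarith
  rw [div_lt_iff₀ hn0] at h1
  rw [lt_div_iff₀ hn0] at h2
  have hp0 : (0 : ℝ) < p n := lt_trans (by positivity) h2
  refine (hXβ n hn).symm.lintegral_le_of_ae_le (hβ n) (hX n)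
    (F := fun b x ↦ ENNReal.ofReal (|signalDeviation lam x b| ^ q))
    ((((measurable_signalDeviation hlam).comp measurable_swap).abs.pow_const q).ennreal_ofReal) ?_
  filter_upwards [hr n hn] with ω hω
  refine (lintegral_signalDeviation_le hlam (hX n) (hrot n hn) hq (by exact_mod_cast hp0)
    (β n ω)).trans (ENNReal.ofReal_le_ofReal ?_)
  rw [hω, mul_assoc, Real.mul_rpow (x := (2 * r ^ 2 / γ) ^ 2) (by positivity) (by positivity),
    ← abs_rpow_eq_sq_rpow, abs_of_nonneg (by positivity), mul_assoc]
  have h3 : r ^ 2 * n / p n ≤ 2 * r ^ 2 / γ := by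
    rw [div_le_div_iff₀ hp0 hγ]
    nlinarith [mul_le_mul_of_nonneg_left h2.le (sq_nonneg r)]
  gcongr
  linarith

end Terms

/-! ### Exact decomposition of the error and conclusion -/

lemma dotProduct_self_eq_of_norm_div_sqrt {n p : ℕ} (hn : 1 ≤ n) {b : Fin p → ℝ} {r : ℝ}
    (h : ‖WithLp.toLp 2 b‖ / √(n : ℝ) = r) : b ⬝ᵥ b = r ^ 2 * n := by
  have hn0 : (0 : ℝ) < n := by exact_mod_cast hn
  rw [← h, div_pow, Real.sq_sqrt hn0.le, div_mul_cancel₀ _ hn0.ne', EuclideanSpace.norm_sq_eq]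
  simp [dotProduct, sq]

/-- An identity with no limit taken. The last term arises because the signal form is centred with
`|b|² / p = r² n / p`, while the target uses `r² / γ`. -/
lemma trainingError_sub_eq {n p : ℕ} {lam γ r σ : ℝ} (hlam : 0 < lam) (hn : 0 < n) (hp : 0 < p)
    (X : Matrix (Fin n) (Fin p) ℝ) {b : Fin p → ℝ} (hb : b ⬝ᵥ b = r ^ 2 * n) (x : Fin n → ℝ) :
    trainingError X (X *ᵥ b + x) lam -
      (r ^ 2 * (lam ^ 2 / γ) *
          (companionStieltjes X (-lam) - lam * deriv (companionStieltjes X) (-lam))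
        + σ ^ 2 * lam ^ 2 * deriv (companionStieltjes X) (-lam)) =
    lam ^ 2 * ((1 / n) * signalDeviation lam X b)
      + 2 * lam ^ 2 * ((1 / n) *
          ((ridgeResolvent X lam * ridgeResolvent X lam) *ᵥ (X *ᵥ b) ⬝ᵥ x))
      + lam ^ 2 * ((1 / n) *
          centredForm (ridgeResolvent X lam * ridgeResolvent X lam) (σ ^ 2) Finset.univ x)
      + lam ^ 2 * r ^ 2 * ((1 / n) * (signalMatrix X lam).trace * (n / p - 1 / γ)) := by
  have hn' : (n : ℝ) ≠ 0 := by exact_mod_cast hn.ne'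
  have hp' : (p : ℝ) ≠ 0 := by exact_mod_cast hp.ne'
  rw [trainingError_eq X hlam, companionStieltjes_neg X hlam, deriv_companionStieltjes_neg X hlam,
    centredForm_univ, signalDeviation, hb]
  have h := trace_signalMatrix X hlam
  have h' : (ridgeResolvent X lam).trace = (signalMatrix X lam).trace
      + lam * (ridgeResolvent X lam * ridgeResolvent X lam).trace := by linarith
  rw [h']
  field_simp
  ring

/-- The normalized trace is at most `(p / n) / λ`, hence bounded, and `n / p → 1 / γ`. -/
lemma tendsto_trace_error {p : ℕ → ℕ} {γ lam : ℝ} (hγ : 0 < γ)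
    (hp : Tendsto (fun n : ℕ => (p n : ℝ) / (n : ℝ)) atTop (𝓝 γ)) (hlam : 0 < lam)
    (X : (n : ℕ) → Matrix (Fin n) (Fin (p n)) ℝ) :
    Tendsto (fun n : ℕ ↦ (1 / (n : ℝ)) * (signalMatrix (X n) lam).trace *
      ((n : ℝ) / (p n : ℝ) - 1 / γ)) atTop (𝓝 0) := by
  have h1 : Tendsto (fun n : ℕ ↦ (n : ℝ) / (p n : ℝ) - 1 / γ) atTop (𝓝 0) := by
    have := (hp.inv₀ hγ.ne').sub_const (1 / γ)
    simpa using this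
  have h2 := (hp.mul_const lam⁻¹).mul h1.norm
  rw [norm_zero, mul_zero] at h2
  refine squeeze_zero_norm (fun n ↦ ?_) h2
  rw [norm_mul]
  gcongr
  rw [Real.norm_eq_abs, abs_mul, abs_of_nonneg (by positivity : (0 : ℝ) ≤ 1 / n)]
  calc _ ≤ 1 / (n : ℝ) * (p n * lam⁻¹) := by gcongr; exact abs_trace_signalMatrix_le (X n) hlam
    _ = _ := by ring

theorem mainTheorem4 {Ω : Type*} [MeasurableSpace Ω] (μ : Measure Ω) [IsProbabilityMeasure μ]
    (p : ℕ → ℕ) (γ r σ : ℝ)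
    -- proportional asymptotics
    (hγ : 0 < γ) (hp : Tendsto (fun n : ℕ => (p n : ℝ) / (n : ℝ)) atTop (𝓝 γ))
    -- designs, signals, noise, and responses
    (X : (n : ℕ) → Ω → Matrix (Fin n) (Fin (p n)) ℝ)
    (β : (n : ℕ) → Ω → (Fin (p n) → ℝ))
    (ε : (n : ℕ) → Ω → (Fin n → ℝ))
    (y : (n : ℕ) → Ω → (Fin n → ℝ))
    (hX : ∀ n, Measurable (X n)) (hβ : ∀ n, Measurable (β n)) (hε : ∀ n, Measurable (ε n))
    (hy : ∀ n ω, y n ω = X n ω *ᵥ β n ω + ε n ω)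
    -- right-rotational invariance and bounded spectrum
    (hrot : ∀ n, 1 ≤ n → IsRightRotationallyInvariant μ (X n))
    (hbdd : ∃ C : ℝ≥0, ∀ᵐ ω ∂μ,
      limsup (fun n => ENNReal.ofReal (maxSingularValue (X n ω))) atTop < (C : ℝ≥0∞))
    -- the signal is independent of the design, the noise is independent of both
    (hXβ : ∀ n, 1 ≤ n → IndepFun (X n) (β n) μ)
    (hXβε : ∀ n, 1 ≤ n → IndepFun (fun ω => (X n ω, β n ω)) (ε n) μ)
    -- normalization of the signal
    (hr : ∀ n, 1 ≤ n → ∀ᵐ ω ∂μ, ‖WithLp.toLp 2 (β n ω)‖ / √(n : ℝ) = r)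
    -- the noise has independent centred entries with variance `σ²` and uniformly bounded
    -- moments of some order `4 + η > 4`
    (hindep : ∀ n, 1 ≤ n → iIndepFun (fun i ω => ε n ω i) μ)
    (hmean : ∀ n i, ∫ ω, ε n ω i ∂μ = 0)
    (hvar : ∀ n i, ∫ ω, (ε n ω i) ^ 2 ∂μ = σ ^ 2)
    (hmom : ∃ η : ℝ, 0 < η ∧ ∃ M : ℝ≥0, ∀ n i,
      ∫⁻ ω, ENNReal.ofReal (|ε n ω i| ^ (4 + η)) ∂μ ≤ (M : ℝ≥0∞)) :
    ∀ lam : ℝ, 0 < lam → ∀ᵐ ω ∂μ,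
      Tendsto (fun n : ℕ =>
        trainingError (X n ω) (y n ω) lam -
          (r ^ 2 * (lam ^ 2 / γ) *
              (companionStieltjes (X n ω) (-lam) - lam * deriv (companionStieltjes (X n ω)) (-lam))
            + σ ^ 2 * lam ^ 2 * deriv (companionStieltjes (X n ω)) (-lam)))
        atTop (𝓝 0) := by
  intro lam hlam
  obtain ⟨η, hη, M, hM⟩ := hmom
  -- Squares of the noise must have `q` moments, so `2 q = 4 + η`.
  have hq : 2 < 2 + η / 2 := by linarith
  have hM' : ∀ n i, ∫⁻ ω, ENNReal.ofReal (|ε n ω i| ^ (2 * (2 + η / 2))) ∂μ ≤ M := fun n i ↦ by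
    rw [show 2 * (2 + η / 2) = 4 + η by ring]
    exact hM n i
  have hr' : ∀ n, 1 ≤ n → ∀ᵐ ω ∂μ, β n ω ⬝ᵥ β n ω = r ^ 2 * n := fun n hn ↦ by
    filter_upwards [hr n hn] with ω hω using dotProduct_self_eq_of_norm_div_sqrt hn hω
  have hXε : ∀ n, 1 ≤ n → IndepFun (X n) (ε n) μ := fun n hn ↦
    (hXβε n hn).comp measurable_fst measurable_id
  have hall : ∀ᵐ ω ∂μ, ∀ n, 1 ≤ n → β n ω ⬝ᵥ β n ω = r ^ 2 * n :=
    ae_all_iff.2 fun n ↦ by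
      by_cases hn : 1 ≤ n
      · filter_upwards [hr' n hn] with ω hω _ using hω
      · exact Eventually.of_forall fun ω h ↦ absurd h hn
  filter_upwards [hall, ae_tendsto_signalDeviation hq hlam hγ hp hX hβ hrot hXβ hr',
    ae_tendsto_noise_linear hq hlam hX hβ hε hXβε hr' hindep hmean hM',
    ae_tendsto_noise_quadratic hq hlam hX hε hXε hindep hmean hvar hM'] with ω h0 h1 h2 h3
  have h4 := tendsto_trace_error hγ hp hlam fun n ↦ X n ω
  have hlim := (((h1.const_mul (lam ^ 2)).add (h2.const_mul (2 * lam ^ 2))).add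
    (h3.const_mul (lam ^ 2))).add (h4.const_mul (lam ^ 2 * r ^ 2))
  simp only [mul_zero, add_zero] at hlim
  refine hlim.congr' ?_
  -- A positive ratio `p / n` forces `p n > 0`, as the decomposition divides by `p`.
  filter_upwards [eventually_ge_atTop 1, hp.eventually_const_lt hγ] with n hn hpn
  have hp0 : 0 < p n := by
    rcases Nat.eq_zero_or_pos (p n) with h | h
    · simp [h] at hpn
    · exact h
  rw [hy, trainingError_sub_eq hlam hn hp0 (X n ω) (h0 n hn)]
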